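/- Let $\mathcal H=l^2(\mathbb Z;\mathbb C^2)$, let $a,b\in\mathbb C$ satisfy $|a|^2+|b|^2=1$ and $0<|a|<1$, and put $C_0=\begin{pmatrix} a & b\\ -\bar b & \bar a\end{pmatrix}\in U(2)$. Let $C_N:[0,\infty)^2\to U(2)$ be $C^1$ (up to the boundary), and put $C(s_1,s_2)=C_0\,C_N(s_1,s_2)$. For $u=(u_1,u_2)^t\in\mathcal H$ define $$(\hat C u)(x)=C(|u_1(x)|^2,|u_2(x)|^2)\,u(x),\qquad (\hat C_0u)(x)=C_0u(x),\qquad (Su)(x)=\begin{pmatrix}u_1(x+1)\\ u_2(x-1)\end{pmatrix},$$ and set $U=S\hat C$ and $U_0=S\hat C_0$. For $u_0\in\mathcal H$ let $U(t)u_0$, $t=0,1,2,\dots$, be the solution of the nonlinear quantum walk, i.e. $U(0)u_0=u_0$ and $U(t+1)u_0=U(U(t)u_0)$. We say that $U(t)u_0$ scatters if there is $u_+\in\mathcal H$ with $\|U(t)u_0-U_0^tu_+\|_{l^2}\to0$ as $t\to\infty$. Let $m\ge 1$ be an integer and suppose that there is a constant $K$ such that for all $s_1,s_2\ge0$ and $j=1,2$,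 $$\|C_N(s_1,s_2)-I_2\|\le K(s_1+s_2)^m,\qquad \|\partial_{s_j}C_N(s_1,s_2)\|\le K(s_1+s_2)^{m-1},$$ where $\|\cdot\|$ is the operator norm of $2\times2$ matrices acting on Euclidean $\mathbb C^2$ (partial derivatives being one-sided at $s_j=0$). 1. If $m=3$, there exists $\delta>0$ such that for every $u_0\in l^2(\mathbb Z;\mathbb C^2)$ with $\|u_0\|_{l^2}<\delta$, $U(t)u_0$ scatters. 2. If $m=2$, there exists $\delta>0$ such that for every $u_0\in l^1(\mathbb Z;\mathbb C^2)$ with $\|u_0\|_{l^1}=\sum_{x}\|u_0(x)\|_{\mathbb C^2}<\delta$, $U(t)u_0$ scatters. -/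

import Mathlib

open scoped Matrix.Norms.L2Operator

noncomputable section

namespace NLQW

/-- `l^p(ℤ; ℂ²)`, where `ℂ²` carries the Euclidean norm. -/
abbrev SeqSpace (p : ENNReal) : Type := lp (fun _ : ℤ => EuclideanSpace ℂ (Fin 2)) p

/-- The state space `ℋ = l²(ℤ; ℂ²)`. -/
abbrev State : Type := SeqSpace 2

/-- The inclusion `l¹(ℤ; ℂ²) ⊆ l²(ℤ; ℂ²)`. -/
def inclusionL1 : SeqSpace 1 →ₗ[ℂ] State :=
  lp.linearMapOfLE ℂ (fun _ : ℤ => EuclideanSpace ℂ (Fin 2)) one_le_two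

lemma summable_norm_sq (u : State) : Summable fun x => ‖u x‖ ^ 2 := by
  have h := (memℓp_gen_iff (by norm_num)).1 (lp.memℓp u)
  simpa using h

lemma memlp_two_of_summable {f : ℤ → EuclideanSpace ℂ (Fin 2)}
    (h : Summable fun x => ‖f x‖ ^ 2) : Memℓp f 2 := by
  refine (memℓp_gen_iff (by norm_num)).2 ?_
  simpa using h

/-- The shift `S = diag(T₋, T₊)`, where `(T_± u)(x) = u(x ∓ 1)`: it maps `(u₁, u₂)` to
`x ↦ (u₁(x + 1), u₂(x - 1))`. -/
def shift (u : State) : State :=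
  ⟨fun x => !₂[u (x + 1) 0, u (x - 1) 1], by
    refine memlp_two_of_summable ?_
    have h := summable_norm_sq u
    have h1 : Summable fun x : ℤ => ‖u (x + 1)‖ ^ 2 :=
      h.comp_injective (add_left_injective (1 : ℤ))
    have h2 : Summable fun x : ℤ => ‖u (x - 1)‖ ^ 2 :=
      h.comp_injective (sub_left_injective (b := (1 : ℤ)))
    refine Summable.of_nonneg_of_le (fun x => by positivity) (fun x => ?_) (h1.add h2)
    rw [EuclideanSpace.norm_sq_eq, EuclideanSpace.norm_sq_eq, EuclideanSpace.norm_sq_eq]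
    simp only [Fin.sum_univ_two]
    simp only [Matrix.cons_val_zero, Matrix.cons_val_one]
    have := sq_nonneg ‖u (x + 1) 1‖
    have := sq_nonneg ‖u (x - 1) 0‖
    linarith⟩

lemma norm_unitary_mulVec (A : Matrix.unitaryGroup (Fin 2) ℂ) (v : EuclideanSpace ℂ (Fin 2)) :
    ‖Matrix.toEuclideanCLM (n := Fin 2) (𝕜 := ℂ) (A : Matrix (Fin 2) (Fin 2) ℂ) v‖ = ‖v‖ := by
  have hA : Matrix.toEuclideanCLM (n := Fin 2) (𝕜 := ℂ) (A : Matrix (Fin 2) (Fin 2) ℂ) ∈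
      unitary (EuclideanSpace ℂ (Fin 2) →L[ℂ] EuclideanSpace ℂ (Fin 2)) :=
    Unitary.map_mem Matrix.toEuclideanCLM A.2
  exact ContinuousLinearMap.norm_map_of_mem_unitary hA v

/-- The nonlinear coin operator `(Ĉ u)(x) = C(|u₁(x)|², |u₂(x)|²) u(x)`. -/
def coinOp (C : ℝ → ℝ → Matrix.unitaryGroup (Fin 2) ℂ) (u : State) : State :=
  ⟨fun x => Matrix.toEuclideanCLM (n := Fin 2) (𝕜 := ℂ)
      (C (‖u x 0‖ ^ 2) (‖u x 1‖ ^ 2) : Matrix (Fin 2) (Fin 2) ℂ) (u x), by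
    refine memlp_two_of_summable ?_
    simpa only [norm_unitary_mulVec] using summable_norm_sq u⟩

/-- One step `U = S Ĉ` of the quantum walk with coin `C`. -/
def step (C : ℝ → ℝ → Matrix.unitaryGroup (Fin 2) ℂ) (u : State) : State :=
  shift (coinOp C u)

/-- The evolution `U(t)`, defined by `U(0) u₀ = u₀` and `U(t + 1) u₀ = U (U(t) u₀)`. -/
def evolution (C : ℝ → ℝ → Matrix.unitaryGroup (Fin 2) ℂ) : ℕ → State → State
  | 0, u₀ => u₀
  | t + 1, u₀ => step C (evolution C t u₀)

/-- The matrix `C₀ = [[a, b], [-b̄, ā]] ∈ U(2)`, for `|a|² + |b|² = 1`. -/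
def constCoin (a b : ℂ) (hab : ‖a‖ ^ 2 + ‖b‖ ^ 2 = 1) : Matrix.unitaryGroup (Fin 2) ℂ :=
  ⟨!![a, b; -(starRingEnd ℂ b), starRingEnd ℂ a], by
    have h : a * starRingEnd ℂ a + b * starRingEnd ℂ b = 1 := by
      rw [Complex.mul_conj', Complex.mul_conj']
      exact_mod_cast hab
    rw [Matrix.mem_unitaryGroup_iff]
    ext i j
    fin_cases i <;> fin_cases j <;>
      simp [Matrix.mul_apply, Fin.sum_univ_two] <;>
      first | linear_combination h | ring⟩

/-- With respect to the linear walk `U₀ = S C₀`, the solution `U(t) u₀` of the walk with coin `C`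
scatters: `‖U(t) u₀ - U₀ᵗ u₊‖ → 0` in `l²` for some `u₊ ∈ ℋ`. -/
def Scatters (C₀ : Matrix.unitaryGroup (Fin 2) ℂ) (C : ℝ → ℝ → Matrix.unitaryGroup (Fin 2) ℂ)
    (u₀ : State) : Prop :=
  ∃ uplus : State, Filter.Tendsto
    (fun t : ℕ => ‖evolution C t u₀ - evolution (fun _ _ => C₀) t uplus‖)
    Filter.atTop (nhds 0)

/-- `C_N` is `C¹` on the closed quadrant `[0, ∞)²` (the only arguments at which a coin is
evaluated), and there `‖C_N(s₁, s₂) - I₂‖ ≤ K (s₁ + s₂)^m` and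
`‖∂_{s_j} C_N(s₁, s₂)‖ ≤ K (s₁ + s₂)^(m - 1)` for `j = 1, 2`, for some constant `K`. The norm is
the operator norm on `ℂ²`; on the boundary of the quadrant the partial derivatives are one-sided
where necessary. Used only for `m ≥ 1`. -/
def NearIdentity (CN : ℝ → ℝ → Matrix.unitaryGroup (Fin 2) ℂ) (m : ℕ) : Prop :=
  ContDiffOn ℝ 1 (fun s : ℝ × ℝ => (CN s.1 s.2 : Matrix (Fin 2) (Fin 2) ℂ))
      (Set.Ici 0 ×ˢ Set.Ici 0) ∧
  ∃ K : ℝ, ∀ s₁ s₂ : ℝ, 0 ≤ s₁ → 0 ≤ s₂ →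
    ‖(CN s₁ s₂ : Matrix (Fin 2) (Fin 2) ℂ) - 1‖ ≤ K * (s₁ + s₂) ^ m ∧
    ‖derivWithin (fun r : ℝ => (CN r s₂ : Matrix (Fin 2) (Fin 2) ℂ)) (Set.Ici 0) s₁‖
      ≤ K * (s₁ + s₂) ^ (m - 1) ∧
    ‖derivWithin (fun r : ℝ => (CN s₁ r : Matrix (Fin 2) (Fin 2) ℂ)) (Set.Ici 0) s₂‖
      ≤ K * (s₁ + s₂) ^ (m - 1)

end NLQW

end

/-! Write N(u) = (C_N - 1)u, so that |N(u)(x)| ≤ K |u(x)|^(2m+1). Duhamel's formula reads U(t)u₀ =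
U₀ᵗ(u₀ + Σ_{s<t} U₀⁻ˢ N(u(s))). Since U₀ is unitary, scattering follows once Σ ‖N(u(t))‖ in l² is
finite (`scatters_of_summable`). That summability is obtained from the decay of the linear walk and
a smallness argument.

Linear decay. The symbol of U₀ has determinant 1 and trace a e^{iξ} + ā e^{-iξ}, so by
Cayley–Hamilton each component of U₀ᵗu solves a scalar second-order recursion. Once the phase of a
is gauged away, its fundamental solution is an oscillatory integral with phase t p(η) ± xη, where
cos p = r cos η and r = |a|. On a quarter period p'' vanishes only at η = π/2. Van der Corput's test
with a cut-off there gives decay t^{-1/3} everywhere, and t^{-3/8} at distance at least 2√t from the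
caustics |x| = rt.

Case m = 3. The t^{-1/3} bound, a TT* argument and a discrete Hardy–Littlewood–Sobolev inequality
give an l⁶ in time, l^∞ in space Strichartz estimate (`exists_strichartz`). As ‖N(u)‖ ≤ K ‖u‖_∞⁶ ‖u‖
in l² and the l² norm is conserved, smallness of u₀ keeps Σ ‖u(t)‖_∞⁶ at most 1.

Case m = 2. Splitting the kernel at the caustics gives l¹ to l⁵ decay at rate t^{-9/40}
(`exists_inclusionL5_le`). The l¹ norm of N(u) is at most K times the fifth power of the l⁵ norm of
u, and 5 · 9/40 = 9/8 > 1. The rate is therefore stable under the Duhamel convolution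
(`exists_sum_decayRate_le`) and the nonlinear terms are summable. -/

namespace NLQW

section Oscillatory

open MeasureTheory intervalIntegral

/-! ### Oscillatory integrals -/

/-- First derivative test for oscillatory integrals with a convex phase. -/
lemma abs_integral_sin_mul_le_of_le_abs_deriv {φ φ' φ'' A A' : ℝ → ℝ} {a b δ M M' : ℝ}
    (hab : a ≤ b) (hδ : 0 < δ)
    (hφ : ∀ x, HasDerivAt φ (φ' x) x) (hφ' : ∀ x, HasDerivAt φ' (φ'' x) x)
    (hφ'' : Continuous φ'') (hA : ∀ x, HasDerivAt A (A' x) x) (hA' : Continuous A')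
    (hpos : ∀ x ∈ Set.Icc a b, 0 ≤ φ'' x) (hlow : ∀ x ∈ Set.Icc a b, δ ≤ |φ' x|)
    (hM : ∀ x, |A x| ≤ M) (hM' : ∀ x, |A' x| ≤ M') :
    |∫ x in a..b, Real.sin (φ x) * A x| ≤ (4 * M + M' * (b - a)) / δ := by
  have cφ : Continuous φ := continuous_iff_continuousAt.2 fun x => (hφ x).continuousAt
  have cφ' : Continuous φ' := continuous_iff_continuousAt.2 fun x => (hφ' x).continuousAt
  have cA : Continuous A := continuous_iff_continuousAt.2 fun x => (hA x).continuousAt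
  have hM0 : 0 ≤ M := (abs_nonneg _).trans (hM a)
  have hM0' : 0 ≤ M' := (abs_nonneg _).trans (hM' a)
  have hne : ∀ x ∈ Set.Icc a b, φ' x ≠ 0 := fun x hx h => by
    have := hlow x hx
    rw [h, abs_zero] at this
    linarith
  have huIcc : Set.uIcc a b = Set.Icc a b := Set.uIcc_of_le hab
  have hinv : ∀ x ∈ Set.Icc a b, |(φ' x)⁻¹| ≤ δ⁻¹ := fun x hx => by
    rw [abs_inv]
    exact inv_anti₀ hδ (hlow x hx)
  have ha : a ∈ Set.Icc a b := Set.left_mem_Icc.2 hab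
  have hb : b ∈ Set.Icc a b := Set.right_mem_Icc.2 hab
  have cinv : ContinuousOn (fun x => (φ' x)⁻¹) (Set.uIcc a b) := by
    rw [huIcc]
    exact cφ'.continuousOn.inv₀ hne
  -- the primitive
  have hF : ∀ x ∈ Set.uIcc a b, HasDerivAt (fun x => -Real.cos (φ x) * A x * (φ' x)⁻¹)
      (Real.sin (φ x) * A x + (-(Real.cos (φ x) * A' x * (φ' x)⁻¹)
        + Real.cos (φ x) * A x * (φ'' x / φ' x ^ 2))) x := by
    intro x hx
    rw [huIcc] at hx
    have h := (((hφ x).cos.neg).mul (hA x)).mul ((hφ' x).inv (hne x hx))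
    refine h.congr_deriv ?_
    have := hne x hx
    simp only [Pi.mul_apply, Pi.neg_apply, Pi.inv_apply]
    field_simp
    ring
  have c1 : ContinuousOn (fun x => Real.sin (φ x) * A x) (Set.uIcc a b) := by fun_prop
  have c2 : ContinuousOn (fun x => Real.cos (φ x) * A' x * (φ' x)⁻¹) (Set.uIcc a b) :=
    ContinuousOn.mul (by fun_prop) cinv
  have cq : ContinuousOn (fun x => φ'' x / φ' x ^ 2) (Set.uIcc a b) := by
    refine hφ''.continuousOn.div (by fun_prop) fun x hx => ?_
    rw [huIcc] at hx
    exact pow_ne_zero _ (hne x hx)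
  have c3 : ContinuousOn (fun x => Real.cos (φ x) * A x * (φ'' x / φ' x ^ 2)) (Set.uIcc a b) :=
    ContinuousOn.mul (by fun_prop) cq
  have i1 := c1.intervalIntegrable (μ := volume)
  have i2 := c2.intervalIntegrable (μ := volume)
  have i3 := c3.intervalIntegrable (μ := volume)
  have i2' : IntervalIntegrable (fun x => -(Real.cos (φ x) * A' x * (φ' x)⁻¹)) volume a b :=
    i2.neg
  have i23 : IntervalIntegrable (fun x => -(Real.cos (φ x) * A' x * (φ' x)⁻¹) +
      Real.cos (φ x) * A x * (φ'' x / φ' x ^ 2)) volume a b := i2'.add i3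
  have key := integral_eq_sub_of_hasDerivAt hF (i1.add i23)
  rw [integral_add i1 i23, integral_add i2' i3, intervalIntegral.integral_neg] at key
  -- bounds
  have b2 : |∫ x in a..b, Real.cos (φ x) * A' x * (φ' x)⁻¹| ≤ M' * δ⁻¹ * (b - a) := by
    have := norm_integral_le_of_norm_le_const (a := a) (b := b) (C := M' * δ⁻¹)
      (f := fun x => Real.cos (φ x) * A' x * (φ' x)⁻¹) (fun x hx => by
        have hx' : x ∈ Set.Icc a b := by
          rw [Set.uIoc_of_le hab] at hx
          exact Set.Ioc_subset_Icc_self hx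
        rw [Real.norm_eq_abs, abs_mul, abs_mul]
        refine mul_le_mul ?_ (hinv x hx') (abs_nonneg _) hM0'
        calc |Real.cos (φ x)| * |A' x| ≤ 1 * M' :=
              mul_le_mul (Real.abs_cos_le_one _) (hM' x) (abs_nonneg _) zero_le_one
          _ = M' := one_mul _)
    rwa [Real.norm_eq_abs, abs_of_nonneg (sub_nonneg.2 hab)] at this
  -- The sign of φ'' turns the absolute integral of (1/φ')' into a difference of endpoint values, at
  -- most 2/δ, with no upper bound on φ''. With the two boundary terms of the primitive this
  -- accounts for 4M.
  have hq : ∫ x in a..b, φ'' x / φ' x ^ 2 = (φ' a)⁻¹ - (φ' b)⁻¹ := by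
    have h : ∀ x ∈ Set.uIcc a b, HasDerivAt (fun x => -(φ' x)⁻¹) (φ'' x / φ' x ^ 2) x := by
      intro x hx
      rw [huIcc] at hx
      refine ((hφ' x).inv (hne x hx)).neg.congr_deriv ?_
      ring
    rw [integral_eq_sub_of_hasDerivAt h cq.intervalIntegrable]
    ring
  have b3 : |∫ x in a..b, Real.cos (φ x) * A x * (φ'' x / φ' x ^ 2)| ≤ M * (2 * δ⁻¹) := by
    have h1 : |∫ x in a..b, Real.cos (φ x) * A x * (φ'' x / φ' x ^ 2)| ≤
        ∫ x in a..b, M * (φ'' x / φ' x ^ 2) := by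
      rw [← Real.norm_eq_abs]
      refine norm_integral_le_of_norm_le hab (Filter.Eventually.of_forall fun x hx => ?_)
        (cq.intervalIntegrable.const_mul M)
      have hx' := Set.Ioc_subset_Icc_self hx
      have h0 : 0 ≤ φ'' x / φ' x ^ 2 := div_nonneg (hpos x hx') (sq_nonneg _)
      rw [Real.norm_eq_abs, abs_mul, abs_mul, abs_of_nonneg h0]
      refine mul_le_mul_of_nonneg_right ?_ h0
      calc |Real.cos (φ x)| * |A x| ≤ 1 * M :=
            mul_le_mul (Real.abs_cos_le_one _) (hM x) (abs_nonneg _) zero_le_one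
        _ = M := one_mul _
    rw [intervalIntegral.integral_const_mul, hq] at h1
    refine h1.trans (mul_le_mul_of_nonneg_left ?_ hM0)
    have := le_abs_self (φ' a)⁻¹
    have := neg_abs_le (φ' b)⁻¹
    linarith [hinv a ha, hinv b hb]
  have bd : ∀ x ∈ Set.Icc a b, |-Real.cos (φ x) * A x * (φ' x)⁻¹| ≤ M * δ⁻¹ := fun x hx => by
    rw [abs_mul, abs_mul, abs_neg]
    refine mul_le_mul ?_ (hinv x hx) (abs_nonneg _) hM0
    calc |Real.cos (φ x)| * |A x| ≤ 1 * M :=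
          mul_le_mul (Real.abs_cos_le_one _) (hM x) (abs_nonneg _) zero_le_one
      _ = M := one_mul _
  have ba := abs_le.1 (bd a ha)
  have bb := abs_le.1 (bd b hb)
  have b2' := abs_le.1 b2
  have b3' := abs_le.1 b3
  have hfin : (4 * M + M' * (b - a)) / δ = 4 * (M * δ⁻¹) + M' * δ⁻¹ * (b - a) := by
    field_simp
  rw [hfin, abs_le]
  constructor <;> linarith

/-- If `g` grows at rate at least `l` and the integral of a bounded `F` over intervals on which
`δ ≤ |g|` is under control, then so is the integral of `F`. -/
lemma abs_integral_le_of_growth {F g : ℝ → ℝ} {a b δ l B M : ℝ} (hab : a ≤ b) (hδ : 0 < δ)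
    (hl : 0 < l) (hF : Continuous F) (hg : Continuous g) (hB0 : 0 ≤ B) (hM : ∀ x, |F x| ≤ M)
    (hgrow : ∀ x ∈ Set.Icc a b, ∀ y ∈ Set.Icc a b, x ≤ y → l * (y - x) ≤ g y - g x)
    (hB : ∀ c d, a ≤ c → c ≤ d → d ≤ b → (∀ x ∈ Set.Icc c d, δ ≤ |g x|) →
      |∫ x in c..d, F x| ≤ B) :
    |∫ x in a..b, F x| ≤ 2 * B + 2 * M * (δ / l) := by
  have hM0 : 0 ≤ M := (abs_nonneg _).trans (hM a)
  -- z is the zero of g or, failing one, the endpoint where g is nearest to zero. Growth at rate l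
  -- forces |g| ≥ δ at distance δ/l from z, so only a window of length 2δ/l needs the trivial bound.
  -- The strict inequalities discard the empty side when z is an endpoint.
  obtain ⟨z, hz, hz1, hz2⟩ : ∃ z ∈ Set.Icc a b, (a < z → g z ≤ 0) ∧ (z < b → 0 ≤ g z) := by
    rcases le_total 0 (g a) with h | h
    · exact ⟨a, Set.left_mem_Icc.2 hab, fun h' => absurd h' (lt_irrefl _), fun _ => h⟩
    · rcases le_total (g b) 0 with h' | h'
      · exact ⟨b, Set.right_mem_Icc.2 hab, fun _ => h', fun h' => absurd h' (lt_irrefl _)⟩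
      · obtain ⟨z, hz, hz0⟩ := intermediate_value_Icc hab hg.continuousOn ⟨h, h'⟩
        exact ⟨z, hz, fun _ => hz0.le, fun _ => hz0.ge⟩
  have hq : 0 < δ / l := div_pos hδ hl
  have hlq : l * (δ / l) = δ := by field_simp
  set c := max a (z - δ / l) with hc
  set d := min b (z + δ / l) with hd
  have hac : a ≤ c := le_max_left _ _
  have hcz : c ≤ z := max_le hz.1 (by linarith)
  have hzd : z ≤ d := le_min hz.2 (by linarith)
  have hdb : d ≤ b := min_le_left _ _
  have h1 : |∫ x in a..c, F x| ≤ B := by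
    rcases eq_or_lt_of_le hac with h | h
    · rw [← h, integral_same, abs_zero]
      exact hB0
    · have hc' : c = z - δ / l := by
        rcases max_choice a (z - δ / l) with h' | h'
        · exact absurd (hc.trans h') h.ne'
        · exact hc.trans h'
      refine hB a c le_rfl hac (hcz.trans hz.2) fun x hx => ?_
      have h2 := hgrow x ⟨hx.1, hx.2.trans (hcz.trans hz.2)⟩ z hz (hx.2.trans hcz)
      have h3 := hz1 (h.trans_le hcz)
      have h4 : l * (δ / l) ≤ l * (z - x) := mul_le_mul_of_nonneg_left (by linarith [hx.2]) hl.le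
      rw [abs_of_nonpos (by linarith)]
      linarith
  have h3 : |∫ x in d..b, F x| ≤ B := by
    rcases eq_or_lt_of_le hdb with h | h
    · rw [h, integral_same, abs_zero]
      exact hB0
    · have hd' : d = z + δ / l := by
        rcases min_choice b (z + δ / l) with h' | h'
        · exact absurd (hd.trans h') h.ne
        · exact hd.trans h'
      refine hB d b (hz.1.trans hzd) hdb le_rfl fun x hx => ?_
      have h2 := hgrow z hz x ⟨hz.1.trans (hzd.trans hx.1), hx.2⟩ (hzd.trans hx.1)
      have h3 := hz2 (hzd.trans_lt h)
      have h4 : l * (δ / l) ≤ l * (x - z) := mul_le_mul_of_nonneg_left (by linarith [hx.1]) hl.le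
      rw [abs_of_nonneg (by linarith)]
      linarith
  have h2 : |∫ x in c..d, F x| ≤ 2 * M * (δ / l) := by
    have := norm_integral_le_of_norm_le_const (a := c) (b := d) (C := M) (f := F)
      (fun x _ => hM x)
    rw [Real.norm_eq_abs, abs_of_nonneg (sub_nonneg.2 (hcz.trans hzd))] at this
    refine this.trans ?_
    have : d - c ≤ 2 * (δ / l) := by
      have := le_max_right a (z - δ / l)
      have := min_le_right b (z + δ / l)
      linarith
    calc M * (d - c) ≤ M * (2 * (δ / l)) := mul_le_mul_of_nonneg_left this hM0
      _ = _ := by ring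
  have hi : ∀ u v : ℝ, IntervalIntegrable F volume u v := fun u v => hF.intervalIntegrable u v
  rw [← integral_add_adjacent_intervals (hi a c) (hi c b),
    ← integral_add_adjacent_intervals (hi c d) (hi d b)]
  have t1 := abs_add_le (∫ x in a..c, F x) ((∫ x in c..d, F x) + ∫ x in d..b, F x)
  have t2 := abs_add_le (∫ x in c..d, F x) (∫ x in d..b, F x)
  linarith

/-- Second derivative test of van der Corput for oscillatory integrals. -/
lemma abs_integral_sin_mul_le_of_le_deriv2 {φ φ' φ'' A A' : ℝ → ℝ} {a b l M M' : ℝ}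
    (hab : a ≤ b) (hl : 0 < l)
    (hφ : ∀ x, HasDerivAt φ (φ' x) x) (hφ' : ∀ x, HasDerivAt φ' (φ'' x) x)
    (hφ'' : Continuous φ'') (hA : ∀ x, HasDerivAt A (A' x) x) (hA' : Continuous A')
    (hlow : ∀ x ∈ Set.Icc a b, l ≤ φ'' x)
    (hM : ∀ x, |A x| ≤ M) (hM' : ∀ x, |A' x| ≤ M') :
    |∫ x in a..b, Real.sin (φ x) * A x| ≤ (10 * M + 2 * M' * (b - a)) / √l := by
  have cφ : Continuous φ := continuous_iff_continuousAt.2 fun x => (hφ x).continuousAt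
  have cφ' : Continuous φ' := continuous_iff_continuousAt.2 fun x => (hφ' x).continuousAt
  have cA : Continuous A := continuous_iff_continuousAt.2 fun x => (hA x).continuousAt
  have hM0 : 0 ≤ M := (abs_nonneg _).trans (hM a)
  have hM0' : 0 ≤ M' := (abs_nonneg _).trans (hM' a)
  have hs : 0 < √l := Real.sqrt_pos.2 hl
  -- The threshold √l balances the two losses 1/δ and δ/l.
  have h := abs_integral_le_of_growth (F := fun x => Real.sin (φ x) * A x) (g := φ') (a := a)
    (b := b) (δ := √l) (l := l) (B := (4 * M + M' * (b - a)) / √l) (M := M) hab hs hl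
    (by fun_prop) cφ' (by have := sub_nonneg.2 hab; positivity) (fun x => by
      rw [abs_mul]
      calc |Real.sin (φ x)| * |A x| ≤ 1 * M :=
            mul_le_mul (Real.abs_sin_le_one _) (hM x) (abs_nonneg _) zero_le_one
        _ = M := one_mul _)
    (fun x hx y hy hxy => by
      refine Convex.mul_sub_le_image_sub_of_le_deriv (convex_Icc a b) cφ'.continuousOn
        (fun z _ => (hφ' z).differentiableAt.differentiableWithinAt) (fun z hz => ?_)
        x hx y hy hxy
      rw [(hφ' z).deriv]
      exact hlow z (interior_subset hz))
    (fun c d hac hcd hdb hcd' => by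
      refine (abs_integral_sin_mul_le_of_le_abs_deriv hcd hs hφ hφ' hφ'' hA hA'
        (fun x hx => hl.le.trans (hlow x ⟨hac.trans hx.1, hx.2.trans hdb⟩)) hcd' hM hM').trans ?_
      have : M' * (d - c) ≤ M' * (b - a) := mul_le_mul_of_nonneg_left (by linarith) hM0'
      gcongr)
  refine h.trans (le_of_eq ?_)
  have : √l / l = 1 / √l := by
    rw [div_eq_div_iff hl.ne' hs.ne', one_mul, Real.mul_self_sqrt hl.le]
  rw [this]
  field_simp
  ring

/-! ### The dispersion relation -/

/-- The phase `p(η)` with `cos p(η) = r cos η`. -/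
noncomputable def phase (r η : ℝ) : ℝ := Real.arccos (r * Real.cos η)

/-- `sin p(η)`. -/
noncomputable def sinPhase (r η : ℝ) : ℝ := √(1 - (r * Real.cos η) ^ 2)

section Phase

variable {r : ℝ}

lemma abs_mul_cos_lt_one (hr0 : 0 < r) (hr1 : r < 1) (η : ℝ) : |r * Real.cos η| < 1 := by
  rw [abs_mul, abs_of_pos hr0]
  nlinarith [Real.abs_cos_le_one η, abs_nonneg (Real.cos η)]

lemma cos_phase (hr0 : 0 < r) (hr1 : r < 1) (η : ℝ) :
    Real.cos (phase r η) = r * Real.cos η := by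
  have h := abs_lt.1 (abs_mul_cos_lt_one hr0 hr1 η)
  exact Real.cos_arccos h.1.le h.2.le

lemma sin_phase (η : ℝ) : Real.sin (phase r η) = sinPhase r η := Real.sin_arccos _

lemma one_sub_sq_le (η : ℝ) : 1 - r ^ 2 ≤ 1 - (r * Real.cos η) ^ 2 := by
  rw [mul_pow]
  nlinarith [Real.cos_sq_le_one η, sq_nonneg r]

lemma one_sub_sq_pos (hr0 : 0 < r) (hr1 : r < 1) : 0 < 1 - r ^ 2 := by nlinarith

lemma sinPhase_sq (hr0 : 0 < r) (hr1 : r < 1) (η : ℝ) :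
    sinPhase r η ^ 2 = 1 - (r * Real.cos η) ^ 2 :=
  Real.sq_sqrt ((one_sub_sq_pos hr0 hr1).le.trans (one_sub_sq_le η))

lemma sinPhase_pos (hr0 : 0 < r) (hr1 : r < 1) (η : ℝ) : 0 < sinPhase r η :=
  Real.sqrt_pos.2 ((one_sub_sq_pos hr0 hr1).trans_le (one_sub_sq_le η))

lemma sinPhase_le_one (η : ℝ) : sinPhase r η ≤ 1 := by
  rw [sinPhase, Real.sqrt_le_one]
  linarith [sq_nonneg (r * Real.cos η)]

lemma sqrt_le_sinPhase (η : ℝ) : √(1 - r ^ 2) ≤ sinPhase r η :=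
  Real.sqrt_le_sqrt (one_sub_sq_le η)

lemma continuous_sinPhase : Continuous (sinPhase r) := by
  unfold sinPhase
  fun_prop

lemma hasDerivAt_sinPhase (hr0 : 0 < r) (hr1 : r < 1) (η : ℝ) :
    HasDerivAt (sinPhase r) (r ^ 2 * Real.cos η * Real.sin η / sinPhase r η) η := by
  have hpos := (one_sub_sq_pos hr0 hr1).trans_le (one_sub_sq_le η)
  have h : HasDerivAt (fun η => 1 - (r * Real.cos η) ^ 2)
      (2 * (r ^ 2 * Real.cos η * Real.sin η)) η := by
    refine ((((Real.hasDerivAt_cos η).const_mul r).pow 2).const_sub 1).congr_deriv ?_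
    ring
  refine (h.sqrt hpos.ne').congr_deriv ?_
  rw [sinPhase]
  field_simp

lemma hasDerivAt_phase (hr0 : 0 < r) (hr1 : r < 1) (η : ℝ) :
    HasDerivAt (phase r) (r * Real.sin η / sinPhase r η) η := by
  have h := abs_lt.1 (abs_mul_cos_lt_one hr0 hr1 η)
  have h1 := (Real.hasDerivAt_arccos h.1.ne' h.2.ne).comp η ((Real.hasDerivAt_cos η).const_mul r)
  refine h1.congr_deriv ?_
  rw [sinPhase]
  ring

/-- The sign of p'' is that of cos η: on [0, π/2] the phase is convex, with its only inflection at
π/2. This degenerate point is what slows the decay from t^{-1/2} to t^{-1/3}. -/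
lemma hasDerivAt_deriv_phase (hr0 : 0 < r) (hr1 : r < 1) (η : ℝ) :
    HasDerivAt (fun η => r * Real.sin η / sinPhase r η)
      (r * (1 - r ^ 2) * Real.cos η / sinPhase r η ^ 3) η := by
  have hne := (sinPhase_pos hr0 hr1 η).ne'
  refine (((Real.hasDerivAt_sin η).const_mul r).div (hasDerivAt_sinPhase hr0 hr1 η)
    hne).congr_deriv ?_
  have hsq := sinPhase_sq hr0 hr1 η
  have hcs := Real.sin_sq_add_cos_sq η
  field_simp
  rw [hsq]
  linear_combination (-(r ^ 2 * Real.cos η)) * hcs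

lemma hasDerivAt_inv_sinPhase (hr0 : 0 < r) (hr1 : r < 1) (η : ℝ) :
    HasDerivAt (fun η => (sinPhase r η)⁻¹)
      (-(r ^ 2 * Real.cos η * Real.sin η) / sinPhase r η ^ 3) η := by
  have hne := (sinPhase_pos hr0 hr1 η).ne'
  refine ((hasDerivAt_sinPhase hr0 hr1 η).inv hne).congr_deriv ?_
  field_simp

lemma continuous_phase : Continuous (phase r) := by
  unfold phase
  fun_prop

/-! ### Estimates of the oscillatory integral -/

/-- The oscillatory integral `∫₀^{π/2} sin(t p(η) + y η) / sin p(η) dη`. -/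
noncomputable def oscInt (r t y : ℝ) : ℝ :=
  ∫ η in (0 : ℝ)..(Real.pi / 2), Real.sin (t * phase r η + y * η) * (sinPhase r η)⁻¹

lemma abs_inv_sinPhase_le (hr0 : 0 < r) (hr1 : r < 1) (η : ℝ) :
    |(sinPhase r η)⁻¹| ≤ (√(1 - r ^ 2))⁻¹ := by
  rw [abs_of_pos (inv_pos.2 (sinPhase_pos hr0 hr1 η))]
  exact inv_anti₀ (Real.sqrt_pos.2 (one_sub_sq_pos hr0 hr1)) (sqrt_le_sinPhase η)

lemma abs_deriv_inv_sinPhase_le (hr0 : 0 < r) (hr1 : r < 1) (η : ℝ) :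
    |-(r ^ 2 * Real.cos η * Real.sin η) / sinPhase r η ^ 3| ≤ ((√(1 - r ^ 2)) ^ 3)⁻¹ := by
  have h0 := Real.sqrt_pos.2 (one_sub_sq_pos hr0 hr1)
  have hp := sinPhase_pos hr0 hr1 η
  rw [abs_div, abs_neg, abs_of_pos (pow_pos hp 3), div_eq_mul_inv]
  have h1 : (sinPhase r η ^ 3)⁻¹ ≤ ((√(1 - r ^ 2)) ^ 3)⁻¹ :=
    inv_anti₀ (pow_pos h0 3) (pow_le_pow_left₀ h0.le (sqrt_le_sinPhase η) 3)
  have h2 : |r ^ 2 * Real.cos η * Real.sin η| ≤ 1 := by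
    rw [abs_mul, abs_mul, abs_of_nonneg (sq_nonneg r)]
    have := Real.abs_cos_le_one η
    have := Real.abs_sin_le_one η
    have hr2 : r ^ 2 ≤ 1 := by nlinarith
    exact mul_le_one₀ (mul_le_one₀ hr2 (abs_nonneg _) (by assumption)) (abs_nonneg _)
      (by assumption)
  calc _ ≤ 1 * (sinPhase r η ^ 3)⁻¹ :=
        mul_le_mul_of_nonneg_right h2 (inv_nonneg.2 (pow_nonneg hp.le 3))
    _ ≤ _ := by rwa [one_mul]

/-- A constant in the estimates of `oscInt`. -/
noncomputable def oscConst (r : ℝ) : ℝ :=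
  10 * (√(1 - r ^ 2))⁻¹ + 2 * ((√(1 - r ^ 2)) ^ 3)⁻¹ * Real.pi

lemma oscConst_pos (hr0 : 0 < r) (hr1 : r < 1) : 0 < oscConst r := by
  have h0 := Real.sqrt_pos.2 (one_sub_sq_pos hr0 hr1)
  have := Real.pi_pos
  unfold oscConst
  positivity

lemma hasDerivAt_oscPhase (hr0 : 0 < r) (hr1 : r < 1) (t y η : ℝ) :
    HasDerivAt (fun η => t * phase r η + y * η) (t * (r * Real.sin η / sinPhase r η) + y) η :=
  (((hasDerivAt_phase hr0 hr1 η).const_mul t).add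
    ((hasDerivAt_id η).const_mul y)).congr_deriv (by simp)

lemma hasDerivAt_deriv_oscPhase (hr0 : 0 < r) (hr1 : r < 1) (t y η : ℝ) :
    HasDerivAt (fun η => t * (r * Real.sin η / sinPhase r η) + y)
      (t * (r * (1 - r ^ 2) * Real.cos η / sinPhase r η ^ 3)) η :=
  ((hasDerivAt_deriv_phase hr0 hr1 η).const_mul t).add_const y

lemma continuous_deriv2_oscPhase (hr0 : 0 < r) (hr1 : r < 1) (t : ℝ) :
    Continuous fun η => t * (r * (1 - r ^ 2) * Real.cos η / sinPhase r η ^ 3) := by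
  have := continuous_sinPhase (r := r)
  refine continuous_const.mul (Continuous.div (by fun_prop) (by fun_prop) fun η => ?_)
  exact pow_ne_zero _ (sinPhase_pos hr0 hr1 η).ne'

lemma continuous_deriv_inv_sinPhase (hr0 : 0 < r) (hr1 : r < 1) :
    Continuous fun η => -(r ^ 2 * Real.cos η * Real.sin η) / sinPhase r η ^ 3 := by
  have := continuous_sinPhase (r := r)
  refine Continuous.div (by fun_prop) (by fun_prop) fun η => ?_
  exact pow_ne_zero _ (sinPhase_pos hr0 hr1 η).ne'

lemma continuous_oscIntegrand (hr0 : 0 < r) (hr1 : r < 1) (t y : ℝ) :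
    Continuous fun η => Real.sin (t * phase r η + y * η) * (sinPhase r η)⁻¹ := by
  have hs := continuous_sinPhase (r := r)
  have hp := continuous_phase (r := r)
  refine Continuous.mul (by fun_prop) (Continuous.inv₀ hs fun η => ?_)
  exact (sinPhase_pos hr0 hr1 η).ne'

lemma abs_oscIntegrand_le (hr0 : 0 < r) (hr1 : r < 1) (t y η : ℝ) :
    |Real.sin (t * phase r η + y * η) * (sinPhase r η)⁻¹| ≤ (√(1 - r ^ 2))⁻¹ := by
  rw [abs_mul]
  calc _ ≤ 1 * (√(1 - r ^ 2))⁻¹ :=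
        mul_le_mul (Real.abs_sin_le_one _) (abs_inv_sinPhase_le hr0 hr1 η) (abs_nonneg _)
          zero_le_one
    _ = _ := one_mul _

/-- The part of `oscInt` away from the inflection point of the phase. -/
lemma abs_oscInt_away_le (hr0 : 0 < r) (hr1 : r < 1) {t ε : ℝ} (ht : 0 < t) (hε : 0 < ε)
    (hε1 : ε ≤ 1) (y : ℝ) :
    |∫ η in (0 : ℝ)..(Real.pi / 2 - ε),
      Real.sin (t * phase r η + y * η) * (sinPhase r η)⁻¹| ≤
      oscConst r / √(r * (1 - r ^ 2) * (t * ε / 2)) := by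
  have hpi := Real.pi_gt_three
  have hc := one_sub_sq_pos hr0 hr1
  have h := abs_integral_sin_mul_le_of_le_deriv2 (a := 0) (b := Real.pi / 2 - ε)
    (l := r * (1 - r ^ 2) * (t * ε / 2)) (by linarith) (by positivity)
    (hasDerivAt_oscPhase hr0 hr1 t y) (hasDerivAt_deriv_oscPhase hr0 hr1 t y)
    (continuous_deriv2_oscPhase hr0 hr1 t) (hasDerivAt_inv_sinPhase hr0 hr1)
    (continuous_deriv_inv_sinPhase hr0 hr1)
    (fun η hη => by
      have hp := sinPhase_pos hr0 hr1 η
      have h1 : sinPhase r η ^ 3 ≤ 1 := pow_le_one₀ hp.le (sinPhase_le_one η)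
      -- Jordan's inequality sin ε ≥ 2ε/π together with π < 4; this is the source of the factor ε/2
      -- in the lower bound for the second derivative.
      have h2 : ε / 2 ≤ Real.cos η := by
        rw [← Real.sin_pi_div_two_sub]
        have h3 := Real.mul_le_sin (x := ε) hε.le (by linarith)
        have h4 : Real.sin ε ≤ Real.sin (Real.pi / 2 - η) :=
          Real.sin_le_sin_of_le_of_le_pi_div_two (by linarith) (by linarith [hη.1])
            (by linarith [hη.2])
        have h5 : ε / 2 ≤ 2 / Real.pi * ε := by
          rw [div_mul_eq_mul_div, div_le_div_iff₀ (by norm_num) Real.pi_pos]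
          nlinarith [Real.pi_lt_four]
        linarith
      have h6 : r * (1 - r ^ 2) * Real.cos η ≤
          r * (1 - r ^ 2) * Real.cos η / sinPhase r η ^ 3 := by
        rw [le_div_iff₀ (pow_pos hp 3)]
        exact mul_le_of_le_one_right (mul_nonneg (by positivity) (by linarith)) h1
      calc r * (1 - r ^ 2) * (t * ε / 2) = t * (r * (1 - r ^ 2) * (ε / 2)) := by ring
        _ ≤ t * (r * (1 - r ^ 2) * Real.cos η) := by gcongr
        _ ≤ _ := by gcongr)
    (abs_inv_sinPhase_le hr0 hr1) (abs_deriv_inv_sinPhase_le hr0 hr1)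
  refine h.trans ?_
  have h0 := Real.sqrt_pos.2 hc
  unfold oscConst
  gcongr
  linarith

lemma oscInt_split (hr0 : 0 < r) (hr1 : r < 1) (t y ε : ℝ) : oscInt r t y =
    (∫ η in (0 : ℝ)..(Real.pi / 2 - ε), Real.sin (t * phase r η + y * η) * (sinPhase r η)⁻¹) +
    ∫ η in (Real.pi / 2 - ε)..(Real.pi / 2),
      Real.sin (t * phase r η + y * η) * (sinPhase r η)⁻¹ :=
  (integral_add_adjacent_intervals
    ((continuous_oscIntegrand hr0 hr1 t y).intervalIntegrable _ _)
    ((continuous_oscIntegrand hr0 hr1 t y).intervalIntegrable _ _)).symm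

/-- An ε-neighbourhood of the inflection point is estimated by its length, the rest by the second
derivative test. The width ε stays free, to be optimised against t. -/
lemma abs_oscInt_le (hr0 : 0 < r) (hr1 : r < 1) {t ε : ℝ} (ht : 0 < t) (hε : 0 < ε)
    (hε1 : ε ≤ 1) (y : ℝ) :
    |oscInt r t y| ≤ oscConst r / √(r * (1 - r ^ 2) * (t * ε / 2)) + oscConst r * ε := by
  rw [oscInt_split hr0 hr1 t y ε]
  refine (abs_add_le _ _).trans (add_le_add (abs_oscInt_away_le hr0 hr1 ht hε hε1 y) ?_)
  have h := norm_integral_le_of_norm_le_const (a := Real.pi / 2 - ε) (b := Real.pi / 2)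
    (f := fun η => Real.sin (t * phase r η + y * η) * (sinPhase r η)⁻¹)
    (fun η _ => abs_oscIntegrand_le hr0 hr1 t y η)
  rw [Real.norm_eq_abs, sub_sub_cancel, abs_of_pos hε] at h
  refine h.trans (mul_le_mul_of_nonneg_right ?_ hε.le)
  have h0 := Real.sqrt_pos.2 (one_sub_sq_pos hr0 hr1)
  have := Real.pi_pos
  have h1 : 0 ≤ 2 * ((√(1 - r ^ 2)) ^ 3)⁻¹ * Real.pi := by positivity
  have h2 : 0 < (√(1 - r ^ 2))⁻¹ := by positivity
  unfold oscConst
  linarith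

/-- Away from the caustic `y = -r t` there is no contribution of the inflection point. -/
lemma abs_oscInt_le_of_far (hr0 : 0 < r) (hr1 : r < 1) {t ε : ℝ} (ht : 0 < t) (hε : 0 < ε)
    (hε1 : ε ≤ 1) {y : ℝ} (hy : 2 * (ε ^ 2 * t) ≤ |y + r * t|) :
    |oscInt r t y| ≤ oscConst r / √(r * (1 - r ^ 2) * (t * ε / 2)) +
      oscConst r / (ε ^ 2 * t) := by
  have hpi := Real.pi_gt_three
  have hc := one_sub_sq_pos hr0 hr1
  rw [oscInt_split hr0 hr1 t y ε]
  refine (abs_add_le _ _).trans (add_le_add (abs_oscInt_away_le hr0 hr1 ht hε hε1 y) ?_)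
  have h := abs_integral_sin_mul_le_of_le_abs_deriv (a := Real.pi / 2 - ε) (b := Real.pi / 2)
    (δ := ε ^ 2 * t) (by linarith) (by positivity)
    (hasDerivAt_oscPhase hr0 hr1 t y) (hasDerivAt_deriv_oscPhase hr0 hr1 t y)
    (continuous_deriv2_oscPhase hr0 hr1 t) (hasDerivAt_inv_sinPhase hr0 hr1)
    (continuous_deriv_inv_sinPhase hr0 hr1)
    (fun η hη => by
      have hp := sinPhase_pos hr0 hr1 η
      have : 0 ≤ Real.cos η := Real.cos_nonneg_of_mem_Icc ⟨by linarith [hη.1], hη.2⟩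
      positivity)
    (fun η hη => by
      have hp := sinPhase_pos hr0 hr1 η
      have hp1 := sinPhase_le_one (r := r) η
      have hs0 : 0 ≤ Real.sin η :=
        Real.sin_nonneg_of_nonneg_of_le_pi (by linarith [hη.1]) (by linarith [hη.2])
      have hcos : 0 ≤ Real.cos η := Real.cos_nonneg_of_mem_Icc ⟨by linarith [hη.1], hη.2⟩
      have hcos' : Real.cos η ≤ ε := by
        rw [← Real.sin_pi_div_two_sub]
        exact (Real.sin_le (by linarith [hη.2])).trans (by linarith [hη.1])
      have hcs := Real.sin_sq_add_cos_sq η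
      have hsq := sinPhase_sq hr0 hr1 η
      have hs1 := Real.sin_le_one η
      have hr2 : r ^ 2 ≤ 1 := by nlinarith
      have u1 : Real.sin η / sinPhase r η ≤ 1 := by
        rw [div_le_one hp]
        refine abs_le_of_sq_le_sq' ?_ hp.le |>.2
        rw [hsq, mul_pow]
        nlinarith [sq_nonneg (Real.cos η)]
      have u2 : 1 - ε ^ 2 ≤ Real.sin η / sinPhase r η := by
        rw [le_div_iff₀ hp]
        have : 1 - ε ^ 2 ≤ Real.sin η ^ 2 := by nlinarith
        nlinarith
      -- On this interval p' increases to its maximum r at π/2, where p'' = 0, so within distance ε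
      -- it falls short of r only quadratically. The phase derivative is thus y + rt up to ε²t, and
      -- `hy` leaves at least ε²t of it.
      have u3 : |t * (r * Real.sin η / sinPhase r η) - r * t| ≤ ε ^ 2 * t := by
        have e : t * (r * Real.sin η / sinPhase r η) - r * t =
            (r * t) * (Real.sin η / sinPhase r η - 1) := by ring
        have hrt : 0 < r * t := by positivity
        rw [e, abs_mul, abs_of_pos hrt, abs_of_nonpos (by linarith)]
        have : r * t ≤ t := mul_le_of_le_one_left ht.le hr1.le
        calc r * t * -(Real.sin η / sinPhase r η - 1) ≤ t * ε ^ 2 :=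
              mul_le_mul this (by linarith) (by linarith) ht.le
          _ = _ := mul_comm _ _
      have u4 : |y + r * t| ≤ |t * (r * Real.sin η / sinPhase r η) + y| +
          |t * (r * Real.sin η / sinPhase r η) - r * t| := by
        have := abs_sub (t * (r * Real.sin η / sinPhase r η) + y)
          (t * (r * Real.sin η / sinPhase r η) - r * t)
        rwa [show t * (r * Real.sin η / sinPhase r η) + y -
          (t * (r * Real.sin η / sinPhase r η) - r * t) = y + r * t by ring] at this
      linarith)
    (abs_inv_sinPhase_le hr0 hr1) (abs_deriv_inv_sinPhase_le hr0 hr1)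
  refine h.trans ?_
  have h0 := Real.sqrt_pos.2 hc
  have e1 : 0 < (√(1 - r ^ 2))⁻¹ := by positivity
  have e2 : 0 < ((√(1 - r ^ 2)) ^ 3)⁻¹ := by positivity
  unfold oscConst
  gcongr ?_ / _
  have : ((√(1 - r ^ 2)) ^ 3)⁻¹ * ε ≤ ((√(1 - r ^ 2)) ^ 3)⁻¹ * (2 * Real.pi) := by
    gcongr
    linarith
  rw [sub_sub_cancel]
  linarith

end Phase

/-! ### The fundamental solution of the wave equation -/

/-- The fundamental solution of the discrete wave equation
`w_{t+2}(x) + w_t(x) = r (w_{t+1}(x+1) + w_{t+1}(x-1))`. -/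
noncomputable def waveKernel (r : ℝ) (t : ℕ) (x : ℤ) : ℝ :=
  -- The integral over the full circle is meant. The reflection η ↦ π - η sends p to π - p and
  -- multiplies the integrand by (-1)^(t+x+1). Even t + x therefore cancels, while odd t + x gives
  -- four equal quarter periods, whence the factor 2/π.
  if Even ((t : ℤ) + x) then 0 else
    2 / Real.pi * ∫ η in (0 : ℝ)..(Real.pi / 2),
      Real.cos (x * η) * Real.sin (t * phase r η) * (sinPhase r η)⁻¹

section Kernel

variable {r : ℝ}

lemma waveKernel_zero (x : ℤ) : waveKernel r 0 x = 0 := by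
  simp [waveKernel]

lemma waveKernel_one (hr0 : 0 < r) (hr1 : r < 1) (x : ℤ) :
    waveKernel r 1 x = if x = 0 then 1 else 0 := by
  have h1 : ∀ η, Real.cos (x * η) * Real.sin ((1 : ℕ) * phase r η) * (sinPhase r η)⁻¹ =
      Real.cos (x * η) := fun η => by
    rw [Nat.cast_one, one_mul, sin_phase, mul_assoc,
      mul_inv_cancel₀ (sinPhase_pos hr0 hr1 η).ne', mul_one]
  simp only [waveKernel, h1]
  rcases eq_or_ne x 0 with rfl | hx
  · have := Real.pi_pos.ne'
    simp
  · rw [if_neg hx]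
    split_ifs with he
    · rfl
    · have hx' : (x : ℝ) ≠ 0 := by exact_mod_cast hx
      have hx2 : Even x := by
        rw [Int.even_add] at he
        by_contra h
        exact he (by simp [h])
      obtain ⟨k, rfl⟩ := hx2
      rw [intervalIntegral.integral_comp_mul_left (fun η => Real.cos η) hx', integral_cos]
      have : ((k + k : ℤ) : ℝ) * (Real.pi / 2) = k * Real.pi := by
        push_cast
        ring
      rw [this, Real.sin_int_mul_pi]
      simp

lemma continuous_kernelIntegrand (hr0 : 0 < r) (hr1 : r < 1) (t y : ℝ) :
    Continuous fun η => Real.cos (y * η) * Real.sin (t * phase r η) * (sinPhase r η)⁻¹ := by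
  have hs := continuous_sinPhase (r := r)
  have hp := continuous_phase (r := r)
  refine Continuous.mul (by fun_prop) (Continuous.inv₀ hs fun η => ?_)
  exact (sinPhase_pos hr0 hr1 η).ne'

/-- Sum-to-product formulas give 2 sin((t+1)p) cos p for the sum in time and 2 cos(xη) cos η for the
sum in space; since cos p = r cos η, the recursion holds under the integral sign. All four terms
belong to the same parity class. -/
lemma waveKernel_add_two (hr0 : 0 < r) (hr1 : r < 1) (t : ℕ) (x : ℤ) :
    waveKernel r (t + 2) x + waveKernel r t x =
      r * (waveKernel r (t + 1) (x + 1) + waveKernel r (t + 1) (x - 1)) := by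
  have e1 : Even (((t + 2 : ℕ) : ℤ) + x) ↔ Even ((t : ℤ) + x) := by
    push_cast
    rw [show (t : ℤ) + 2 + x = (t + x) + 2 by ring]
    simp [Int.even_add]
  have e2 : Even (((t + 1 : ℕ) : ℤ) + (x + 1)) ↔ Even ((t : ℤ) + x) := by
    push_cast
    rw [show (t : ℤ) + 1 + (x + 1) = (t + x) + 2 by ring]
    simp [Int.even_add]
  have e3 : Even (((t + 1 : ℕ) : ℤ) + (x - 1)) ↔ Even ((t : ℤ) + x) := by
    push_cast
    rw [show (t : ℤ) + 1 + (x - 1) = t + x by ring]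
  simp only [waveKernel, e1, e2, e3]
  split_ifs with h
  · simp
  · have hi : ∀ t y : ℝ, IntervalIntegrable
        (fun η => Real.cos (y * η) * Real.sin (t * phase r η) * (sinPhase r η)⁻¹)
        volume 0 (Real.pi / 2) :=
      fun t y => (continuous_kernelIntegrand hr0 hr1 t y).intervalIntegrable _ _
    rw [← mul_add, ← mul_add, mul_left_comm, ← intervalIntegral.integral_add (hi _ _) (hi _ _),
      ← intervalIntegral.integral_add (hi _ _) (hi _ _),
      ← intervalIntegral.integral_const_mul r]
    congr 1
    refine integral_congr fun η _ => ?_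
    have hc := cos_phase hr0 hr1 η
    push_cast
    have s1 : Real.sin ((t + 2) * phase r η) + Real.sin (t * phase r η) =
        2 * Real.sin ((t + 1) * phase r η) * (r * Real.cos η) := by
      rw [← hc, show ((t : ℝ) + 2) * phase r η = (t + 1) * phase r η + phase r η by ring,
        show (t : ℝ) * phase r η = (t + 1) * phase r η - phase r η by ring,
        Real.sin_add, Real.sin_sub]
      ring
    have s2 : Real.cos ((x + 1) * η) + Real.cos ((x - 1) * η) =
        2 * Real.cos (x * η) * Real.cos η := by
      rw [show ((x : ℝ) + 1) * η = x * η + η by ring, show ((x : ℝ) - 1) * η = x * η - η by ring,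
        Real.cos_add, Real.cos_sub]
      ring
    linear_combination (Real.cos (x * η) * (sinPhase r η)⁻¹) * s1 -
      (r * Real.sin ((t + 1) * phase r η) * (sinPhase r η)⁻¹) * s2

lemma abs_waveKernel_le_oscInt (hr0 : 0 < r) (hr1 : r < 1) (t : ℕ) (x : ℤ) :
    |waveKernel r t x| ≤ |oscInt r t x| + |oscInt r t (-x)| := by
  unfold waveKernel
  split_ifs with h
  · rw [abs_zero]
    positivity
  · have hi : ∀ y : ℝ, IntervalIntegrable
        (fun η => Real.sin (t * phase r η + y * η) * (sinPhase r η)⁻¹) volume 0 (Real.pi / 2) :=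
      fun y => (continuous_oscIntegrand hr0 hr1 t y).intervalIntegrable _ _
    have e : 2 / Real.pi * ∫ η in (0 : ℝ)..(Real.pi / 2),
        Real.cos (x * η) * Real.sin (t * phase r η) * (sinPhase r η)⁻¹ =
        (Real.pi)⁻¹ * (oscInt r t x + oscInt r t (-x)) := by
      rw [oscInt, oscInt, ← intervalIntegral.integral_add (hi _) (hi _),
        ← intervalIntegral.integral_const_mul, ← intervalIntegral.integral_const_mul]
      refine integral_congr fun η _ => ?_
      rw [neg_mul, ← sub_eq_add_neg, Real.sin_add, Real.sin_sub]
      ring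
    have hp : (Real.pi)⁻¹ ≤ 1 := inv_le_one_of_one_le₀ (by linarith [Real.pi_gt_three])
    rw [e, abs_mul, abs_of_pos (inv_pos.2 Real.pi_pos)]
    calc _ ≤ 1 * |oscInt r t x + oscInt r t (-x)| :=
          mul_le_mul_of_nonneg_right hp (abs_nonneg _)
      _ ≤ _ := by
          rw [one_mul]
          exact abs_add_le _ _

/-! ### Pointwise and summed decay of the wave kernel -/

/-- A constant in the pointwise estimates of `waveKernel`. -/
noncomputable def kernelConst (r : ℝ) : ℝ :=
  2 * (oscConst r * ((√(r * (1 - r ^ 2) / 2))⁻¹ + 1))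

lemma kernelConst_pos (hr0 : 0 < r) (hr1 : r < 1) : 0 < kernelConst r := by
  have := oscConst_pos hr0 hr1
  unfold kernelConst
  positivity

lemma oscConst_div_sqrt {t ε u : ℝ} (hr0 : 0 < r) (hr1 : r < 1) (hu : 0 < u)
    (h : t * ε = u ^ 2) : oscConst r / √(r * (1 - r ^ 2) * (t * ε / 2)) =
      oscConst r * (√(r * (1 - r ^ 2) / 2))⁻¹ * u⁻¹ := by
  have hc := one_sub_sq_pos hr0 hr1
  rw [show r * (1 - r ^ 2) * (t * ε / 2) = (r * (1 - r ^ 2) / 2) * u ^ 2 by rw [h]; ring,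
    Real.sqrt_mul (by positivity), Real.sqrt_sq hu.le, div_eq_mul_inv, mul_inv, mul_assoc]

/-- The width ε = t^{-1/3} balances (tε)^{-1/2} against ε. -/
lemma abs_waveKernel_le (hr0 : 0 < r) (hr1 : r < 1) {t : ℕ} (ht : 1 ≤ t) (x : ℤ) :
    |waveKernel r t x| ≤ kernelConst r * (t : ℝ) ^ (-(1 / 3) : ℝ) := by
  have ht1 : (1 : ℝ) ≤ t := by exact_mod_cast ht
  have ht0 : (0 : ℝ) < t := by linarith
  have h : ∀ y : ℝ, |oscInt r t y| ≤
      oscConst r * ((√(r * (1 - r ^ 2) / 2))⁻¹ + 1) * (t : ℝ) ^ (-(1 / 3) : ℝ) := fun y => by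
    have h1 := abs_oscInt_le hr0 hr1 ht0 (Real.rpow_pos_of_pos ht0 (-(1 / 3)))
      (Real.rpow_le_one_of_one_le_of_nonpos ht1 (by norm_num)) y
    rw [oscConst_div_sqrt hr0 hr1 (Real.rpow_pos_of_pos ht0 (1 / 3)) (by
      rw [← Real.rpow_natCast, ← Real.rpow_mul ht0.le]
      nth_rewrite 1 [← Real.rpow_one (t : ℝ)]
      rw [← Real.rpow_add ht0]
      norm_num), ← Real.rpow_neg ht0.le] at h1
    linarith
  have := abs_waveKernel_le_oscInt hr0 hr1 t x
  unfold kernelConst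
  linarith [h x, h (-x)]

/-- With ε = t^{-1/4} the requirement 2ε²t becomes the distance 2√t from the caustic; of the two
resulting terms, (tε)^{-1/2} = t^{-3/8} dominates (ε²t)^{-1} = t^{-1/2}. -/
lemma abs_waveKernel_le_of_far (hr0 : 0 < r) (hr1 : r < 1) {t : ℕ} (ht : 1 ≤ t) {x : ℤ}
    (hx : 2 * (t : ℝ) ^ (1 / 2 : ℝ) ≤ |(|(x : ℝ)| - r * t)|) :
    |waveKernel r t x| ≤ kernelConst r * (t : ℝ) ^ (-(3 / 8) : ℝ) := by
  have ht1 : (1 : ℝ) ≤ t := by exact_mod_cast ht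
  have ht0 : (0 : ℝ) < t := by linarith
  have hC := oscConst_pos hr0 hr1
  have h2 : ((t : ℝ) ^ (-(1 / 4) : ℝ)) ^ 2 * t = (t : ℝ) ^ (1 / 2 : ℝ) := by
    rw [← Real.rpow_natCast, ← Real.rpow_mul ht0.le]
    nth_rewrite 2 [← Real.rpow_one (t : ℝ)]
    rw [← Real.rpow_add ht0]
    norm_num
  have h : ∀ y : ℝ, 2 * (t : ℝ) ^ (1 / 2 : ℝ) ≤ |y + r * t| → |oscInt r t y| ≤
      oscConst r * ((√(r * (1 - r ^ 2) / 2))⁻¹ + 1) * (t : ℝ) ^ (-(3 / 8) : ℝ) := fun y hy => by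
    have h1 := abs_oscInt_le_of_far hr0 hr1 ht0 (Real.rpow_pos_of_pos ht0 (-(1 / 4)))
      (Real.rpow_le_one_of_one_le_of_nonpos ht1 (by norm_num)) (y := y) (by rwa [h2])
    rw [oscConst_div_sqrt hr0 hr1 (Real.rpow_pos_of_pos ht0 (3 / 8)) (by
      rw [← Real.rpow_natCast, ← Real.rpow_mul ht0.le]
      nth_rewrite 1 [← Real.rpow_one (t : ℝ)]
      rw [← Real.rpow_add ht0]
      norm_num), ← Real.rpow_neg ht0.le, h2, div_eq_mul_inv (oscConst r),
      ← Real.rpow_neg ht0.le] at h1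
    have h3 : (t : ℝ) ^ (-(1 / 2) : ℝ) ≤ (t : ℝ) ^ (-(3 / 8) : ℝ) :=
      Real.rpow_le_rpow_of_exponent_le ht1 (by norm_num)
    have := mul_le_mul_of_nonneg_left h3 hC.le
    linarith
  have hrt : |-(r * t)| = r * t := by
    rw [abs_neg, abs_of_pos (by positivity)]
  have k1 : 2 * (t : ℝ) ^ (1 / 2 : ℝ) ≤ |(x : ℝ) + r * t| := by
    have := abs_abs_sub_abs_le (x : ℝ) (-(r * t))
    rw [hrt, sub_neg_eq_add] at this
    exact hx.trans this
  have k2 : 2 * (t : ℝ) ^ (1 / 2 : ℝ) ≤ |-(x : ℝ) + r * t| := by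
    have := abs_abs_sub_abs_le (-(x : ℝ)) (-(r * t))
    rw [hrt, sub_neg_eq_add, abs_neg (x : ℝ)] at this
    exact hx.trans this
  have := abs_waveKernel_le_oscInt hr0 hr1 t x
  unfold kernelConst
  linarith [h x k1, h (-x) k2]

/-- An interval of length `2 L` contains at most `2 L + 1` integers. -/
lemma card_filter_abs_sub_le (s : Finset ℤ) (c L : ℝ) (hL : 0 ≤ L) :
    ((s.filter fun x : ℤ => |(x : ℝ) - c| ≤ L).card : ℝ) ≤ 2 * L + 1 := by
  have h : (s.filter fun x : ℤ => |(x : ℝ) - c| ≤ L) ⊆ Finset.Icc ⌈c - L⌉ ⌊c + L⌋ := by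
    intro x hx
    have hx' := abs_le.1 (Finset.mem_filter.1 hx).2
    rw [Finset.mem_Icc, Int.ceil_le, Int.le_floor]
    constructor <;> linarith
  have h1 : ((s.filter fun x : ℤ => |(x : ℝ) - c| ≤ L).card : ℝ) ≤
      ((⌊c + L⌋ + 1 - ⌈c - L⌉).toNat : ℝ) := by
    have := Finset.card_le_card h
    rw [Int.card_Icc] at this
    exact_mod_cast this
  refine h1.trans ?_
  have h2 : ((⌊c + L⌋ + 1 - ⌈c - L⌉).toNat : ℝ) =
      ((max (⌊c + L⌋ + 1 - ⌈c - L⌉) 0 : ℤ) : ℝ) := by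
    rw [← Int.toNat_eq_max]
    norm_cast
  rw [h2]
  push_cast
  refine max_le ?_ (by linarith)
  have := Int.floor_le (c + L)
  have := Int.le_ceil (c - L)
  linarith

/-- `l⁵`-decay of the kernel, granted its boundedness in `l²`. -/
lemma sum_abs_waveKernel_pow_five_le (hr0 : 0 < r) (hr1 : r < 1) {t : ℕ} (ht : 1 ≤ t) {B : ℝ}
    (hB : ∀ s : Finset ℤ, ∑ x ∈ s, |waveKernel r t x| ^ 2 ≤ B) (s : Finset ℤ) :
    ∑ x ∈ s, |waveKernel r t x| ^ 5 ≤
      (10 * kernelConst r ^ 5 + kernelConst r ^ 3 * B) * (t : ℝ) ^ (-(9 / 8) : ℝ) := by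
  classical
  have ht1 : (1 : ℝ) ≤ t := by exact_mod_cast ht
  have ht0 : (0 : ℝ) < t := by linarith
  have hC := kernelConst_pos hr0 hr1
  set L : ℝ := 2 * (t : ℝ) ^ (1 / 2 : ℝ) with hL
  have hsq1 : 1 ≤ (t : ℝ) ^ (1 / 2 : ℝ) := Real.one_le_rpow ht1 (by norm_num)
  -- Near the caustics there are at most 10√t sites, each contributing t^{-5/3}, in total t^{-7/6}.
  -- Far from them three of the five factors give t^{-9/8} and the other two are absorbed by the l²
  -- bound B.
  rw [← Finset.sum_filter_add_sum_filter_not s (fun x : ℤ => L ≤ |(|(x : ℝ)| - r * t)|), add_comm]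
  rw [add_mul]
  refine add_le_add ?_ ?_
  · have hcard : ((s.filter fun x : ℤ => ¬ L ≤ |(|(x : ℝ)| - r * t)|).card : ℝ) ≤
        10 * (t : ℝ) ^ (1 / 2 : ℝ) := by
      have hsub : (s.filter fun x : ℤ => ¬ L ≤ |(|(x : ℝ)| - r * t)|) ⊆
          (s.filter fun x : ℤ => |(x : ℝ) - r * t| ≤ L) ∪
          (s.filter fun x : ℤ => |(x : ℝ) - -(r * t)| ≤ L) := by
        intro x hx
        rw [Finset.mem_filter, not_le] at hx
        rw [Finset.mem_union, Finset.mem_filter, Finset.mem_filter]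
        rcases abs_choice (x : ℝ) with h | h
        · left
          rw [h] at hx
          exact ⟨hx.1, hx.2.le⟩
        · right
          rw [h] at hx
          refine ⟨hx.1, ?_⟩
          rw [← abs_neg, show -((x : ℝ) - -(r * t)) = -(x : ℝ) - r * t by ring]
          exact hx.2.le
      have h1 : ((s.filter fun x : ℤ => ¬ L ≤ |(|(x : ℝ)| - r * t)|).card : ℝ) ≤
          ((s.filter fun x : ℤ => |(x : ℝ) - r * t| ≤ L).card : ℝ) +
          ((s.filter fun x : ℤ => |(x : ℝ) - -(r * t)| ≤ L).card : ℝ) := by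
        exact_mod_cast (Finset.card_le_card hsub).trans (Finset.card_union_le _ _)
      have h2 := card_filter_abs_sub_le s (r * t) L (by positivity)
      have h3 := card_filter_abs_sub_le s (-(r * t)) L (by positivity)
      linarith
    have hterm : ∀ x ∈ s.filter fun x : ℤ => ¬ L ≤ |(|(x : ℝ)| - r * t)|,
        |waveKernel r t x| ^ 5 ≤ kernelConst r ^ 5 * (t : ℝ) ^ (-(5 / 3) : ℝ) := fun x _ => by
      refine (pow_le_pow_left₀ (abs_nonneg _) (abs_waveKernel_le hr0 hr1 ht x) 5).trans_eq ?_
      rw [mul_pow, ← Real.rpow_natCast ((t : ℝ) ^ (-(1 / 3) : ℝ)), ← Real.rpow_mul ht0.le]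
      norm_num
    refine (Finset.sum_le_card_nsmul _ _ _ hterm).trans ?_
    rw [nsmul_eq_mul]
    have hrp : (t : ℝ) ^ (1 / 2 : ℝ) * (t : ℝ) ^ (-(5 / 3) : ℝ) ≤ (t : ℝ) ^ (-(9 / 8) : ℝ) := by
      rw [← Real.rpow_add ht0]
      exact Real.rpow_le_rpow_of_exponent_le ht1 (by norm_num)
    calc _ ≤ 10 * (t : ℝ) ^ (1 / 2 : ℝ) * (kernelConst r ^ 5 * (t : ℝ) ^ (-(5 / 3) : ℝ)) := by
          gcongr
      _ = 10 * kernelConst r ^ 5 * ((t : ℝ) ^ (1 / 2 : ℝ) * (t : ℝ) ^ (-(5 / 3) : ℝ)) := by ring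
      _ ≤ _ := by gcongr
  · have hterm : ∀ x ∈ s.filter fun x : ℤ => L ≤ |(|(x : ℝ)| - r * t)|,
        |waveKernel r t x| ^ 5 ≤
          kernelConst r ^ 3 * (t : ℝ) ^ (-(9 / 8) : ℝ) * |waveKernel r t x| ^ 2 := fun x hx => by
      have h1 := abs_waveKernel_le_of_far hr0 hr1 ht (Finset.mem_filter.1 hx).2
      have h2 : |waveKernel r t x| ^ 3 ≤ kernelConst r ^ 3 * (t : ℝ) ^ (-(9 / 8) : ℝ) := by
        refine (pow_le_pow_left₀ (abs_nonneg _) h1 3).trans_eq ?_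
        rw [mul_pow, ← Real.rpow_natCast ((t : ℝ) ^ (-(3 / 8) : ℝ)), ← Real.rpow_mul ht0.le]
        norm_num
      calc _ = |waveKernel r t x| ^ 3 * |waveKernel r t x| ^ 2 := by ring
        _ ≤ _ := by gcongr
    refine (Finset.sum_le_sum hterm).trans ?_
    rw [← Finset.mul_sum]
    calc _ ≤ kernelConst r ^ 3 * (t : ℝ) ^ (-(9 / 8) : ℝ) * B := by
          gcongr
          exact hB _
      _ = _ := by ring

end Kernel

end Oscillatory

/-! ### The linear walk -/

lemma norm_sq_eq_tsum (u : State) : ‖u‖ ^ 2 = ∑' x, ‖u x‖ ^ 2 := by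
  have h := lp.norm_rpow_eq_tsum (p := 2) (by norm_num) u
  simpa using h

lemma sum_norm_sq_le (u : State) (s : Finset ℤ) : ∑ x ∈ s, ‖u x‖ ^ 2 ≤ ‖u‖ ^ 2 := by
  rw [norm_sq_eq_tsum]
  exact (summable_norm_sq u).sum_le_tsum s fun _ _ => sq_nonneg _

lemma norm_sq_euclidean (v : EuclideanSpace ℂ (Fin 2)) : ‖v‖ ^ 2 = ‖v 0‖ ^ 2 + ‖v 1‖ ^ 2 := by
  rw [EuclideanSpace.norm_sq_eq, Fin.sum_univ_two]

lemma norm_le_add (v : EuclideanSpace ℂ (Fin 2)) : ‖v‖ ≤ ‖v 0‖ + ‖v 1‖ := by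
  refine abs_le_of_sq_le_sq' ?_ (by positivity) |>.2
  rw [norm_sq_euclidean]
  nlinarith [norm_nonneg (v 0), norm_nonneg (v 1)]

lemma shift_apply_zero (u : State) (x : ℤ) : shift u x 0 = u (x + 1) 0 := rfl

lemma shift_apply_one (u : State) (x : ℤ) : shift u x 1 = u (x - 1) 1 := rfl

lemma coinOp_apply (C : ℝ → ℝ → Matrix.unitaryGroup (Fin 2) ℂ) (u : State) (x : ℤ) :
    coinOp C u x = Matrix.toEuclideanCLM (n := Fin 2) (𝕜 := ℂ)
      (C (‖u x 0‖ ^ 2) (‖u x 1‖ ^ 2) : Matrix (Fin 2) (Fin 2) ℂ) (u x) := rfl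

lemma summable_norm_sq_apply (u : State) (j : Fin 2) : Summable fun x => ‖u x j‖ ^ 2 :=
  (summable_norm_sq u).of_nonneg_of_le (fun _ => sq_nonneg _)
    fun _ => pow_le_pow_left₀ (norm_nonneg _) (PiLp.norm_apply_le _ _) 2

lemma norm_shift (u : State) : ‖shift u‖ = ‖u‖ := by
  have h : ∀ v : State, ‖v‖ ^ 2 = (∑' x, ‖v x 0‖ ^ 2) + ∑' x, ‖v x 1‖ ^ 2 := fun v => by
    rw [norm_sq_eq_tsum, ← (summable_norm_sq_apply v 0).tsum_add (summable_norm_sq_apply v 1)]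
    simp only [norm_sq_euclidean]
  have h2 : ‖shift u‖ ^ 2 = ‖u‖ ^ 2 := by
    rw [h, h]
    congr 1
    · exact (Equiv.addRight (1 : ℤ)).tsum_eq fun x => ‖u x 0‖ ^ 2
    · exact (Equiv.subRight (1 : ℤ)).tsum_eq fun x => ‖u x 1‖ ^ 2
  exact (pow_left_inj₀ (norm_nonneg _) (norm_nonneg _) two_ne_zero).1 h2

lemma norm_coinOp (C : ℝ → ℝ → Matrix.unitaryGroup (Fin 2) ℂ) (u : State) :
    ‖coinOp C u‖ = ‖u‖ := by
  have h2 : ‖coinOp C u‖ ^ 2 = ‖u‖ ^ 2 := by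
    rw [norm_sq_eq_tsum, norm_sq_eq_tsum]
    simp only [coinOp_apply, norm_unitary_mulVec]
  exact (pow_left_inj₀ (norm_nonneg _) (norm_nonneg _) two_ne_zero).1 h2

lemma norm_evolution (C : ℝ → ℝ → Matrix.unitaryGroup (Fin 2) ℂ) (t : ℕ) (u : State) :
    ‖evolution C t u‖ = ‖u‖ := by
  induction t with
  | zero => rfl
  | succ t ih => rw [evolution, step, norm_shift, norm_coinOp, ih]

section Linear

variable (a b : ℂ) (hab : ‖a‖ ^ 2 + ‖b‖ ^ 2 = 1)

lemma step_constCoin_zero (u : State) (x : ℤ) :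
    step (fun _ _ => constCoin a b hab) u x 0 = a * u (x + 1) 0 + b * u (x + 1) 1 := by
  rw [step, shift_apply_zero, coinOp_apply, Matrix.ofLp_toEuclideanCLM]
  simp [constCoin, Matrix.mulVec, dotProduct, Fin.sum_univ_two]

lemma step_constCoin_one (u : State) (x : ℤ) :
    step (fun _ _ => constCoin a b hab) u x 1 =
      -(starRingEnd ℂ b) * u (x - 1) 0 + starRingEnd ℂ a * u (x - 1) 1 := by
  rw [step, shift_apply_one, coinOp_apply, Matrix.ofLp_toEuclideanCLM]
  simp [constCoin, Matrix.mulVec, dotProduct, Fin.sum_univ_two]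

lemma state_ext {u v : State} (h : ∀ x j, u x j = v x j) : u = v :=
  lp.ext (funext fun x => PiLp.ext fun j => h x j)

lemma add_apply_apply (u v : State) (x : ℤ) (j : Fin 2) : (u + v) x j = u x j + v x j := rfl

lemma smul_apply_apply (c : ℂ) (u : State) (x : ℤ) (j : Fin 2) : (c • u) x j = c * u x j := rfl

/-- The linear walk `U₀ = S C₀` as a linear isometry. -/
noncomputable def linearWalkIsometry : State →ₗᵢ[ℂ] State where
  toFun := step fun _ _ => constCoin a b hab
  map_add' u v := state_ext fun x j => by
    fin_cases j
    · simp only [Fin.zero_eta, step_constCoin_zero, add_apply_apply]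
      ring
    · simp only [Fin.mk_one, step_constCoin_one, add_apply_apply]
      ring
  map_smul' c u := state_ext fun x j => by
    fin_cases j
    · simp only [Fin.zero_eta, step_constCoin_zero, smul_apply_apply, RingHom.id_apply]
      ring
    · simp only [Fin.mk_one, step_constCoin_one, smul_apply_apply, RingHom.id_apply]
      ring
  norm_map' u := by
    change ‖step _ u‖ = _
    rw [step, norm_shift, norm_coinOp]

lemma linearWalkIsometry_surjective : Function.Surjective (linearWalkIsometry a b hab) := by
  intro v
  have hs : Summable fun x : ℤ => ‖v (x - 1) 0‖ ^ 2 + ‖v (x + 1) 1‖ ^ 2 :=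
    ((summable_norm_sq_apply v 0).comp_injective (sub_left_injective (b := (1 : ℤ)))).add
      ((summable_norm_sq_apply v 1).comp_injective (add_left_injective (1 : ℤ)))
  -- w is the inverse shift of v.
  let w : State := ⟨fun x => !₂[v (x - 1) 0, v (x + 1) 1], memlp_two_of_summable (by
    simpa only [norm_sq_euclidean, Matrix.cons_val_zero, Matrix.cons_val_one] using hs)⟩
  refine ⟨coinOp (fun _ _ => (constCoin a b hab)⁻¹) w, state_ext fun x j => ?_⟩
  have hw : coinOp (fun _ _ => constCoin a b hab)
      (coinOp (fun _ _ => (constCoin a b hab)⁻¹) w) = w := by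
    refine lp.ext (funext fun x => ?_)
    rw [coinOp_apply, coinOp_apply, ← mul_apply_eq_comp, ← map_mul,
      ← Submonoid.coe_mul, mul_inv_cancel]
    simp
  change shift (coinOp _ _) x j = _
  rw [hw]
  fin_cases j
  · change v (x + 1 - 1) 0 = _
    rw [add_sub_cancel_right]
    rfl
  · change v (x - 1 + 1) 1 = _
    rw [sub_add_cancel]
    rfl

/-- The linear walk `U₀ = S C₀` as a unitary operator. -/
noncomputable def linearWalk : State ≃ₗᵢ[ℂ] State :=
  LinearIsometryEquiv.ofSurjective (linearWalkIsometry a b hab)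
    (linearWalkIsometry_surjective a b hab)

lemma linearWalk_apply (u : State) :
    linearWalk a b hab u = step (fun _ _ => constCoin a b hab) u := rfl

lemma linearWalk_pow_succ_apply (t : ℕ) (u : State) :
    (linearWalk a b hab ^ (t + 1)) u = linearWalk a b hab ((linearWalk a b hab ^ t) u) := by
  rw [pow_succ']
  rfl

lemma evolution_constCoin (t : ℕ) (u : State) :
    evolution (fun _ _ => constCoin a b hab) t u = (linearWalk a b hab ^ t) u := by
  induction t with
  | zero => rfl
  | succ t ih => rw [evolution, ih, linearWalk_pow_succ_apply, linearWalk_apply]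

/-- Every component of a solution of the linear walk solves a discrete wave equation. -/
lemma linearWalk_linearWalk_apply (u : State) (x : ℤ) (j : Fin 2) :
    linearWalk a b hab (linearWalk a b hab u) x j + u x j =
      a * linearWalk a b hab u (x + 1) j + starRingEnd ℂ a * linearWalk a b hab u (x - 1) j := by
  -- Underlying identity: U₀² + 1 = (trace) U₀ for the symbol of U₀, whose determinant is |a|² +
  -- |b|² = 1 and whose trace is a scalar shift operator.
  have h : a * starRingEnd ℂ a + b * starRingEnd ℂ b = 1 := by
    rw [Complex.mul_conj', Complex.mul_conj']
    exact_mod_cast hab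
  fin_cases j
  · simp only [Fin.zero_eta, linearWalk_apply, step_constCoin_zero, step_constCoin_one,
      add_sub_cancel_right, sub_add_cancel]
    linear_combination (-u x 0) * h
  · simp only [Fin.mk_one, linearWalk_apply, step_constCoin_zero, step_constCoin_one,
      add_sub_cancel_right, sub_add_cancel]
    linear_combination (-u x 1) * h

end Linear

/-- The fundamental solution of the wave equation
`w_{t+2}(x) + w_t(x) = a w_{t+1}(x+1) + ā w_{t+1}(x-1)`. -/
noncomputable def gaugedKernel (a : ℂ) (t : ℕ) (x : ℤ) : ℂ :=
  (a / ‖a‖) ^ (-x) * waveKernel ‖a‖ t x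

section Gauged

variable {a : ℂ}

lemma norm_gaugedKernel (ha₀ : 0 < ‖a‖) (t : ℕ) (x : ℤ) : ‖gaugedKernel a t x‖ = |waveKernel ‖a‖ t x| := by
  have : ‖a / (‖a‖ : ℂ)‖ = 1 := by
    rw [norm_div, Complex.norm_real, norm_norm, div_self ha₀.ne']
  rw [gaugedKernel, norm_mul, norm_zpow, this, one_zpow, one_mul, Complex.norm_real,
    Real.norm_eq_abs]

lemma gaugedKernel_zero (x : ℤ) : gaugedKernel a 0 x = 0 := by
  simp [gaugedKernel, waveKernel_zero]

lemma gaugedKernel_one (ha₀ : 0 < ‖a‖) (ha₁ : ‖a‖ < 1) (x : ℤ) : gaugedKernel a 1 x = if x = 0 then 1 else 0 := by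
  rw [gaugedKernel, waveKernel_one ha₀ ha₁]
  split_ifs with h
  · simp [h]
  · simp

/-- Conjugation by the unimodular factor (a/|a|)^{-x} replaces both coefficients a and ā by |a|,
without changing any modulus. -/
lemma gaugedKernel_add_two (ha₀ : 0 < ‖a‖) (ha₁ : ‖a‖ < 1) (t : ℕ) (x : ℤ) :
    gaugedKernel a (t + 2) x + gaugedKernel a t x =
      a * gaugedKernel a (t + 1) (x + 1) + starRingEnd ℂ a * gaugedKernel a (t + 1) (x - 1) := by
  have h : (waveKernel ‖a‖ (t + 2) x : ℂ) + waveKernel ‖a‖ t x =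
      ‖a‖ * (waveKernel ‖a‖ (t + 1) (x + 1) + waveKernel ‖a‖ (t + 1) (x - 1)) := by
    exact_mod_cast waveKernel_add_two ha₀ ha₁ t x
  have hr : (‖a‖ : ℂ) ≠ 0 := by exact_mod_cast ha₀.ne'
  have ha : a ≠ 0 := norm_pos_iff.1 ha₀
  have hω : a / (‖a‖ : ℂ) ≠ 0 := div_ne_zero ha hr
  have e1 : a * (a / (‖a‖ : ℂ)) ^ (-(x + 1)) = ‖a‖ * (a / (‖a‖ : ℂ)) ^ (-x) := by
    rw [neg_add, zpow_add₀ hω, zpow_neg_one]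
    field_simp
  have e2 : starRingEnd ℂ a * (a / (‖a‖ : ℂ)) ^ (-(x - 1)) = ‖a‖ * (a / (‖a‖ : ℂ)) ^ (-x) := by
    have := Complex.mul_conj' a
    rw [show -(x - 1) = -x + 1 by ring, zpow_add₀ hω, zpow_one]
    field_simp
    linear_combination this
  simp only [gaugedKernel]
  linear_combination (a / (‖a‖ : ℂ)) ^ (-x) * h - waveKernel ‖a‖ (t + 1) (x + 1) * e1 -
    waveKernel ‖a‖ (t + 1) (x - 1) * e2

/-- Solution formula for the wave equation with data supported in one point each. -/
lemma wave_eq_gaugedKernel (ha₀ : 0 < ‖a‖) (ha₁ : ‖a‖ < 1) {f : ℕ → ℤ → ℂ} {α β : ℂ} {y z : ℤ}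
    (hf : ∀ t x, f (t + 2) x + f t x = a * f (t + 1) (x + 1) + starRingEnd ℂ a * f (t + 1) (x - 1))
    (h0 : ∀ x, f 0 x = if x = y then α else 0) (h1 : ∀ x, f 1 x = if x = z then β else 0)
    (t : ℕ) (x : ℤ) :
    f (t + 1) x = β * gaugedKernel a (t + 1) (x - z) - α * gaugedKernel a t (x - y) := by
  -- Run backwards from time 0, the recursion would assign -K₁ to time -1, K being the kernel; hence
  -- -K delayed by one step carries the data at time 0. Time -1 is not indexed, so the case 1 below
  -- has to be checked separately.
  have hz : ∀ x, f 1 x = β * gaugedKernel a 1 (x - z) - α * gaugedKernel a 0 (x - y) := fun x => by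
    rw [h1, gaugedKernel_one ha₀ ha₁, gaugedKernel_zero]
    by_cases h : x = z <;> simp [h, sub_eq_zero]
  induction t using Nat.strong_induction_on generalizing x with
  | _ t ih =>
    match t with
    | 0 => exact hz x
    | 1 =>
      have k1 := gaugedKernel_add_two ha₀ ha₁ 0 (x - z)
      have k0 : f 0 x = α * gaugedKernel a 1 (x - y) := by
        rw [h0, gaugedKernel_one ha₀ ha₁]
        by_cases h : x = y <;> simp [h, sub_eq_zero]
      have k2 := hf 0 x
      have k3 := hz (x + 1)
      have k4 := hz (x - 1)
      simp only [zero_add, gaugedKernel_zero] at k1 k2 k3 k4 ⊢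
      rw [add_sub_right_comm] at k3
      rw [sub_right_comm] at k4
      linear_combination k2 - k0 + a * k3 + starRingEnd ℂ a * k4 - β * k1
    | t + 2 =>
      have k1 := gaugedKernel_add_two ha₀ ha₁ (t + 1) (x - z)
      have k0 := gaugedKernel_add_two ha₀ ha₁ t (x - y)
      have k2 := hf (t + 1) x
      have k3 := ih (t + 1) (by omega) (x + 1)
      have k4 := ih (t + 1) (by omega) (x - 1)
      have k5 := ih t (by omega) x
      rw [add_sub_right_comm, add_sub_right_comm] at k3
      rw [sub_right_comm, sub_right_comm x 1 y] at k4
      linear_combination k2 - k5 + a * k3 + starRingEnd ℂ a * k4 - β * k1 + α * k0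

end Gauged

/-! ### Decay of the linear walk -/

lemma single_apply_apply (y : ℤ) (v : EuclideanSpace ℂ (Fin 2)) (x : ℤ) (j : Fin 2) :
    (lp.single 2 y v : State) x j = if x = y then v j else 0 := by
  rw [lp.single_apply, Pi.single_apply]
  split_ifs <;> rfl

lemma norm_single (y : ℤ) (v : EuclideanSpace ℂ (Fin 2)) :
    ‖(lp.single 2 y v : State)‖ = ‖v‖ :=
  lp.norm_single (E := fun _ : ℤ => EuclideanSpace ℂ (Fin 2)) (p := 2) (by norm_num) y v

section Decay

variable {a b : ℂ} (hab : ‖a‖ ^ 2 + ‖b‖ ^ 2 = 1)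

lemma linearWalk_pow_wave (u : State) (j : Fin 2) (t : ℕ) (x : ℤ) :
    (linearWalk a b hab ^ (t + 2)) u x j + (linearWalk a b hab ^ t) u x j =
      a * (linearWalk a b hab ^ (t + 1)) u (x + 1) j +
        starRingEnd ℂ a * (linearWalk a b hab ^ (t + 1)) u (x - 1) j := by
  rw [linearWalk_pow_succ_apply, linearWalk_pow_succ_apply]
  exact linearWalk_linearWalk_apply a b hab _ x j

/-- One step carries the upper component one site to the left, so the datum at time 1 sits at y - 1;
for the lower component it sits at y + 1. -/
lemma linearWalk_pow_single_zero (ha₀ : 0 < ‖a‖) (ha₁ : ‖a‖ < 1) (y : ℤ)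
    (v : EuclideanSpace ℂ (Fin 2)) (t : ℕ) (x : ℤ) :
    (linearWalk a b hab ^ (t + 1)) (lp.single 2 y v) x 0 =
      (a * v 0 + b * v 1) * gaugedKernel a (t + 1) (x - (y - 1)) -
        v 0 * gaugedKernel a t (x - y) := by
  refine wave_eq_gaugedKernel (f := fun t x => (linearWalk a b hab ^ t) (lp.single 2 y v) x 0)
    ha₀ ha₁ (linearWalk_pow_wave hab _ 0) (fun x => single_apply_apply y v x 0) (fun x => ?_) t x
  simp only [pow_one, linearWalk_apply, step_constCoin_zero, single_apply_apply]
  by_cases h : x = y - 1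
  · simp [h]
  · have : x + 1 ≠ y := fun h' => h (by omega)
    simp [h, this]

lemma linearWalk_pow_single_one (ha₀ : 0 < ‖a‖) (ha₁ : ‖a‖ < 1) (y : ℤ)
    (v : EuclideanSpace ℂ (Fin 2)) (t : ℕ) (x : ℤ) :
    (linearWalk a b hab ^ (t + 1)) (lp.single 2 y v) x 1 =
      (-(starRingEnd ℂ b) * v 0 + starRingEnd ℂ a * v 1) *
        gaugedKernel a (t + 1) (x - (y + 1)) - v 1 * gaugedKernel a t (x - y) := by
  refine wave_eq_gaugedKernel (f := fun t x => (linearWalk a b hab ^ t) (lp.single 2 y v) x 1)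
    ha₀ ha₁ (linearWalk_pow_wave hab _ 1) (fun x => single_apply_apply y v x 1) (fun x => ?_) t x
  simp only [pow_one, linearWalk_apply, step_constCoin_one, single_apply_apply]
  by_cases h : x = y + 1
  · simp [h]
  · have : x - 1 ≠ y := fun h' => h (by omega)
    simp [h, this]

include hab in
lemma norm_snd_pos (ha₁ : ‖a‖ < 1) : 0 < ‖b‖ := by
  have := norm_nonneg a
  refine norm_pos_iff.2 fun h => ?_
  rw [h, norm_zero] at hab
  nlinarith

-- Unitarity gives the l² bound without touching the integral: for the source e₀ at site -1, the
-- lower component vanishes at time 0 and is concentrated at 0 at time 1, so it equals -b̄ times the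
-- kernel. Here b ≠ 0 because |a| < 1.
include hab in
lemma sum_abs_waveKernel_sq_le (ha₀ : 0 < ‖a‖) (ha₁ : ‖a‖ < 1) (t : ℕ) (s : Finset ℤ) :
    ∑ x ∈ s, |waveKernel ‖a‖ t x| ^ 2 ≤ (‖b‖ ^ 2)⁻¹ := by
  have hb := norm_snd_pos hab ha₁
  match t with
  | 0 =>
    simp only [waveKernel_zero, abs_zero, ne_eq, OfNat.ofNat_ne_zero, not_false_eq_true, zero_pow,
      Finset.sum_const_zero]
    positivity
  | t + 1 =>
    set v : EuclideanSpace ℂ (Fin 2) := EuclideanSpace.single 0 1 with hv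
    set u := (linearWalk a b hab ^ (t + 1)) (lp.single 2 (-1) v) with hu
    have h1 : ∀ x, ‖b‖ ^ 2 * |waveKernel ‖a‖ (t + 1) x| ^ 2 ≤ ‖u x‖ ^ 2 := fun x => by
      have h2 : u x 1 = -(starRingEnd ℂ b) * gaugedKernel a (t + 1) x := by
        rw [hu, linearWalk_pow_single_one hab ha₀ ha₁]
        simp [hv]
      rw [← norm_gaugedKernel ha₀, ← mul_pow]
      refine pow_le_pow_left₀ (by positivity) ?_ 2
      calc ‖b‖ * ‖gaugedKernel a (t + 1) x‖ = ‖u x 1‖ := by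
            rw [h2, norm_mul, norm_neg, RCLike.norm_conj]
        _ ≤ ‖u x‖ := PiLp.norm_apply_le _ _
    have h3 : ‖b‖ ^ 2 * ∑ x ∈ s, |waveKernel ‖a‖ (t + 1) x| ^ 2 ≤ 1 := by
      rw [Finset.mul_sum]
      refine (Finset.sum_le_sum fun x _ => h1 x).trans ((sum_norm_sq_le u s).trans ?_)
      rw [hu, LinearIsometryEquiv.norm_map, norm_single, hv]
      simp
    rw [← one_div, le_div_iff₀ (by positivity), mul_comm]
    exact h3

/-- Serves to pass from time t to 1 + t at the cost of 2^q ≤ 4. -/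
lemma rpow_neg_le_four_mul {t : ℝ} (ht : 1 ≤ t) {q : ℝ} (hq0 : 0 ≤ q) (hq2 : q ≤ 2) :
    t ^ (-q) ≤ 4 * (1 + t) ^ (-q) := by
  have h0 : 0 < t := by linarith
  have h2 : (2 : ℝ) ^ q ≤ 4 := by
    refine (Real.rpow_le_rpow_of_exponent_le one_le_two hq2).trans_eq ?_
    norm_num
  have h1 : (1 + t) ^ q ≤ 4 * t ^ q := by
    calc (1 + t) ^ q ≤ (2 * t) ^ q := Real.rpow_le_rpow (by linarith) (by linarith) hq0
      _ = 2 ^ q * t ^ q := Real.mul_rpow (by norm_num) h0.le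
      _ ≤ _ := by gcongr
  rw [Real.rpow_neg h0.le, Real.rpow_neg (by linarith), ← div_eq_mul_inv, inv_eq_one_div,
    div_le_div_iff₀ (Real.rpow_pos_of_pos h0 q) (Real.rpow_pos_of_pos (by linarith) q)]
  linarith

lemma abs_waveKernel_le_bracket (ha₀ : 0 < ‖a‖) (ha₁ : ‖a‖ < 1) (t : ℕ) (x : ℤ) :
    |waveKernel ‖a‖ t x| ≤ 4 * kernelConst ‖a‖ * (1 + t : ℝ) ^ (-(1 / 3) : ℝ) := by
  have hC := kernelConst_pos ha₀ ha₁
  rcases Nat.eq_zero_or_pos t with rfl | ht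
  · rw [waveKernel_zero, abs_zero]
    positivity
  · have h := rpow_neg_le_four_mul (t := t) (q := 1 / 3) (by exact_mod_cast ht) (by norm_num)
      (by norm_num)
    calc _ ≤ _ := abs_waveKernel_le ha₀ ha₁ ht x
      _ ≤ kernelConst ‖a‖ * (4 * (1 + t : ℝ) ^ (-(1 / 3) : ℝ)) := by gcongr
      _ = _ := by ring

include hab in
lemma exists_sum_abs_waveKernel_pow_five_le (ha₀ : 0 < ‖a‖) (ha₁ : ‖a‖ < 1) :
    ∃ D : ℝ, 0 < D ∧ ∀ (t : ℕ) (s : Finset ℤ),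
      ∑ x ∈ s, |waveKernel ‖a‖ t x| ^ 5 ≤ D * (1 + t : ℝ) ^ (-(9 / 8) : ℝ) := by
  have hC := kernelConst_pos ha₀ ha₁
  have hb := norm_snd_pos hab ha₁
  set D₀ := 10 * kernelConst ‖a‖ ^ 5 + kernelConst ‖a‖ ^ 3 * (‖b‖ ^ 2)⁻¹ with hD₀
  have hD₀pos : 0 < D₀ := by positivity
  refine ⟨4 * D₀, by positivity, fun t s => ?_⟩
  rcases Nat.eq_zero_or_pos t with rfl | ht
  · simp only [waveKernel_zero, abs_zero, ne_eq, OfNat.ofNat_ne_zero, not_false_eq_true, zero_pow,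
      Finset.sum_const_zero]
    positivity
  · have h := rpow_neg_le_four_mul (t := t) (q := 9 / 8) (by exact_mod_cast ht) (by norm_num)
      (by norm_num)
    calc _ ≤ _ := sum_abs_waveKernel_pow_five_le ha₀ ha₁ ht
            (sum_abs_waveKernel_sq_le hab ha₀ ha₁ t) s
      _ ≤ D₀ * (4 * (1 + t : ℝ) ^ (-(9 / 8) : ℝ)) := by gcongr
      _ = _ := by ring

lemma norm_comb_le {z w : ℂ} (hz : ‖z‖ ≤ 1) (hw : ‖w‖ ≤ 1) (v : EuclideanSpace ℂ (Fin 2)) :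
    ‖z * v 0 + w * v 1‖ ≤ 2 * ‖v‖ := by
  have h0 := PiLp.norm_apply_le v 0
  have h1 := PiLp.norm_apply_le v 1
  calc _ ≤ ‖z‖ * ‖v 0‖ + ‖w‖ * ‖v 1‖ := by
        simpa only [norm_mul] using norm_add_le (z * v 0) (w * v 1)
    _ ≤ 1 * ‖v‖ + 1 * ‖v‖ := by gcongr
    _ = _ := by ring

/-- The evolution of a point source is dominated by three translates of the wave kernel. -/
lemma norm_linearWalk_pow_single_le (ha₀ : 0 < ‖a‖) (ha₁ : ‖a‖ < 1) (y : ℤ)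
    (v : EuclideanSpace ℂ (Fin 2)) (t : ℕ) (x : ℤ) :
    ‖(linearWalk a b hab ^ (t + 1)) (lp.single 2 y v) x‖ ≤
      2 * ‖v‖ * (|waveKernel ‖a‖ (t + 1) (x - (y - 1))| +
        |waveKernel ‖a‖ (t + 1) (x - (y + 1))| + |waveKernel ‖a‖ t (x - y)|) := by
  have hb₁ : ‖b‖ ≤ 1 := by nlinarith [norm_nonneg b, sq_nonneg ‖a‖]
  have h0 := PiLp.norm_apply_le v 0
  have h1 := PiLp.norm_apply_le v 1
  have k0 : ‖a * v 0 + b * v 1‖ ≤ 2 * ‖v‖ := norm_comb_le ha₁.le hb₁ v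
  have k1 : ‖-(starRingEnd ℂ b) * v 0 + starRingEnd ℂ a * v 1‖ ≤ 2 * ‖v‖ :=
    norm_comb_le (by rwa [norm_neg, RCLike.norm_conj]) (by rw [RCLike.norm_conj]; exact ha₁.le) v
  refine (norm_le_add _).trans ?_
  rw [linearWalk_pow_single_zero hab ha₀ ha₁, linearWalk_pow_single_one hab ha₀ ha₁]
  refine (add_le_add (norm_sub_le _ _) (norm_sub_le _ _)).trans ?_
  simp only [norm_mul, norm_gaugedKernel ha₀]
  calc _ ≤ (2 * ‖v‖ * |waveKernel ‖a‖ (t + 1) (x - (y - 1))| +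
          ‖v‖ * |waveKernel ‖a‖ t (x - y)|) +
          (2 * ‖v‖ * |waveKernel ‖a‖ (t + 1) (x - (y + 1))| +
          ‖v‖ * |waveKernel ‖a‖ t (x - y)|) := by
        gcongr
    _ = _ := by ring

/-- Dispersive estimate for point sources. -/
lemma exists_norm_linearWalk_pow_single_le (ha₀ : 0 < ‖a‖) (ha₁ : ‖a‖ < 1) :
    ∃ D : ℝ, 0 < D ∧ ∀ (t : ℕ) (x y : ℤ) (v : EuclideanSpace ℂ (Fin 2)),
      ‖(linearWalk a b hab ^ t) (lp.single 2 y v) x‖ ≤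
        D * (1 + t : ℝ) ^ (-(1 / 3) : ℝ) * ‖v‖ := by
  have hC := kernelConst_pos ha₀ ha₁
  -- 48 = 2(4 + 4 + 4 · 4), the last kernel being one time step behind; the summand 1 covers t = 0.
  refine ⟨1 + 48 * kernelConst ‖a‖, by positivity, fun t x y v => ?_⟩
  match t with
  | 0 =>
    have h1 : ‖(lp.single 2 y v : State) x‖ ≤ ‖v‖ := by
      have := lp.norm_apply_le_norm two_ne_zero (lp.single 2 y v : State) x
      rwa [norm_single] at this
    refine h1.trans ?_
    simp only [Nat.cast_zero, add_zero, Real.one_rpow, mul_one]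
    exact le_mul_of_one_le_left (norm_nonneg v) (by linarith)
  | t + 1 =>
    refine (norm_linearWalk_pow_single_le hab ha₀ ha₁ y v t x).trans ?_
    set ρ := (1 + ((t + 1 : ℕ) : ℝ)) ^ (-(1 / 3) : ℝ) with hρ
    have hρ0 : 0 < ρ := by positivity
    have h1 := abs_waveKernel_le_bracket ha₀ ha₁ (t + 1) (x - (y - 1))
    have h2 := abs_waveKernel_le_bracket ha₀ ha₁ (t + 1) (x - (y + 1))
    have h3 := abs_waveKernel_le_bracket ha₀ ha₁ t (x - y)
    have h4 := rpow_neg_le_four_mul (t := 1 + t) (q := 1 / 3)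
      (le_add_of_nonneg_right (Nat.cast_nonneg t)) (by norm_num) (by norm_num)
    rw [show (1 : ℝ) + (1 + t) = 1 + ((t + 1 : ℕ) : ℝ) by push_cast; ring] at h4
    have h5 : 4 * kernelConst ‖a‖ * (1 + t : ℝ) ^ (-(1 / 3) : ℝ) ≤
        4 * kernelConst ‖a‖ * (4 * ρ) := by gcongr
    calc _ ≤ 2 * ‖v‖ * (4 * kernelConst ‖a‖ * ρ + 4 * kernelConst ‖a‖ * ρ +
          4 * kernelConst ‖a‖ * (4 * ρ)) := by
          gcongr
          exact h3.trans h5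
      _ = 48 * kernelConst ‖a‖ * ρ * ‖v‖ := by ring
      _ ≤ _ := by
          gcongr
          linarith

end Decay

/-! ### Decay in `l⁵` -/

instance fact_one_le_five : Fact ((1 : ENNReal) ≤ 5) := ⟨by norm_num⟩

lemma norm_pow_five_eq_tsum (u : SeqSpace 5) : ‖u‖ ^ 5 = ∑' x, ‖u x‖ ^ 5 := by
  have h := lp.norm_rpow_eq_tsum (p := 5) (by norm_num) u
  simpa using h

lemma summable_norm_pow_five (u : SeqSpace 5) : Summable fun x => ‖u x‖ ^ 5 := by
  have h := (memℓp_gen_iff (by norm_num)).1 (lp.memℓp u)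
  simpa using h

lemma norm_le_of_sum_pow_five_le {u : SeqSpace 5} {C : ℝ} (hC : 0 ≤ C)
    (h : ∀ s : Finset ℤ, ∑ x ∈ s, ‖u x‖ ^ 5 ≤ C ^ 5) : ‖u‖ ≤ C := by
  refine lp.norm_le_of_forall_sum_le (by norm_num) hC fun s => ?_
  simpa using h s

lemma norm_linearMapOfLE_five_le (u : State) :
    ‖lp.linearMapOfLE ℂ (fun _ : ℤ => EuclideanSpace ℂ (Fin 2))
      (by norm_num : (2 : ENNReal) ≤ 5) u‖ ≤ ‖u‖ := by
  refine norm_le_of_sum_pow_five_le (norm_nonneg u) fun s => ?_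
  simp only [lp.coe_linearMapOfLE_apply]
  calc ∑ x ∈ s, ‖u x‖ ^ 5 ≤ ∑ x ∈ s, ‖u‖ ^ 3 * ‖u x‖ ^ 2 :=
        Finset.sum_le_sum fun x _ => by
          rw [show ‖u x‖ ^ 5 = ‖u x‖ ^ 3 * ‖u x‖ ^ 2 by ring]
          gcongr
          exact lp.norm_apply_le_norm two_ne_zero u x
    _ ≤ ‖u‖ ^ 3 * ‖u‖ ^ 2 := by
        rw [← Finset.mul_sum]
        gcongr
        exact sum_norm_sq_le u s
    _ = _ := by ring

/-- The inclusion `l² ⊆ l⁵`. -/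
noncomputable def inclusionL5 : State →L[ℂ] SeqSpace 5 :=
  (lp.linearMapOfLE ℂ (fun _ : ℤ => EuclideanSpace ℂ (Fin 2))
    (by norm_num : (2 : ENNReal) ≤ 5)).mkContinuous 1 fun u => by
      rw [one_mul]
      exact norm_linearMapOfLE_five_le u

lemma norm_inclusionL5_le (u : State) : ‖inclusionL5 u‖ ≤ ‖u‖ := norm_linearMapOfLE_five_le u

lemma inclusionL5_apply (u : State) (x : ℤ) : inclusionL5 u x = u x := rfl

lemma add_add_pow_five_le {p q r : ℝ} (hp : 0 ≤ p) (hq : 0 ≤ q) (hr : 0 ≤ r) :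
    (p + q + r) ^ 5 ≤ 243 * (p ^ 5 + q ^ 5 + r ^ 5) := by
  set m := max p (max q r) with hm
  have hp' : p ≤ m := le_max_left _ _
  have hq' : q ≤ m := (le_max_left _ _).trans (le_max_right _ _)
  have hr' : r ≤ m := (le_max_right _ _).trans (le_max_right _ _)
  have h1 : (p + q + r) ^ 5 ≤ (3 * m) ^ 5 := pow_le_pow_left₀ (by positivity) (by linarith) 5
  have h2 : m ^ 5 ≤ p ^ 5 + q ^ 5 + r ^ 5 := by
    have := pow_nonneg hp 5
    have := pow_nonneg hq 5
    have := pow_nonneg hr 5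
    rcases max_choice p (max q r) with h | h
    · rw [hm, h]
      linarith
    · rcases max_choice q r with h' | h' <;> rw [hm, h, h'] <;> linarith
  calc _ ≤ _ := h1
    _ = 243 * m ^ 5 := by ring
    _ ≤ _ := by gcongr

section Decay5

variable {a b : ℂ} (hab : ‖a‖ ^ 2 + ‖b‖ ^ 2 = 1)

lemma sum_sub_le {f : ℤ → ℝ} {B : ℝ} (h : ∀ s : Finset ℤ, ∑ x ∈ s, f x ≤ B) (s : Finset ℤ)
    (c : ℤ) : ∑ x ∈ s, f (x - c) ≤ B := by
  have := h (s.map (Equiv.subRight c).toEmbedding)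
  rwa [Finset.sum_map] at this

lemma exists_inclusionL5_single_le (ha₀ : 0 < ‖a‖) (ha₁ : ‖a‖ < 1) :
    ∃ D : ℝ, 0 < D ∧ ∀ (t : ℕ) (y : ℤ) (v : EuclideanSpace ℂ (Fin 2)),
      ‖inclusionL5 ((linearWalk a b hab ^ t) (lp.single 2 y v))‖ ≤
        D * (1 + t : ℝ) ^ (-(9 / 40) : ℝ) * ‖v‖ := by
  obtain ⟨D, hD, hDle⟩ := exists_sum_abs_waveKernel_pow_five_le hab ha₀ ha₁
  -- Here 32 = 2⁵ and 243 = 3⁵ come from the fifth power of a sum of three kernels, and 6D = D + D +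
  -- 4D. Adding 1 ensures E ≤ E⁵, which avoids a fifth root, and also covers t = 0.
  set E : ℝ := 1 + 32 * 243 * (6 * D) with hE
  have hE1 : 1 ≤ E := by rw [hE]; linarith
  refine ⟨E, by linarith, fun t y v => ?_⟩
  refine norm_le_of_sum_pow_five_le (by positivity) fun s => ?_
  simp only [inclusionL5_apply]
  have hr5 : ((1 + t : ℝ) ^ (-(9 / 40) : ℝ)) ^ 5 = (1 + t : ℝ) ^ (-(9 / 8) : ℝ) := by
    rw [← Real.rpow_natCast, ← Real.rpow_mul (by positivity)]
    norm_num
  rw [mul_pow, mul_pow, hr5]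
  have hE5 : E ≤ E ^ 5 := le_self_pow₀ hE1 (by norm_num)
  match t with
  | 0 =>
    simp only [Nat.cast_zero, add_zero, Real.one_rpow, mul_one, pow_zero]
    have h2 : ‖inclusionL5 (lp.single 2 y v : State)‖ ≤ ‖v‖ :=
      (norm_inclusionL5_le _).trans_eq (norm_single y v)
    have h5 : ∑ x ∈ s, ‖(lp.single 2 y v : State) x‖ ^ 5 ≤ ‖v‖ ^ 5 := by
      refine le_trans ?_ (pow_le_pow_left₀ (norm_nonneg _) h2 5)
      rw [norm_pow_five_eq_tsum]
      exact (summable_norm_pow_five (inclusionL5 (lp.single 2 y v : State))).sum_le_tsum s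
        fun _ _ => by positivity
    exact h5.trans (le_mul_of_one_le_left (by positivity) (hE1.trans hE5))
  | t + 1 =>
    set ρ := (1 + ((t + 1 : ℕ) : ℝ)) ^ (-(9 / 8) : ℝ) with hρ
    have hρ0 : 0 < ρ := by positivity
    have h4 := rpow_neg_le_four_mul (t := 1 + t) (q := 9 / 8)
      (le_add_of_nonneg_right (Nat.cast_nonneg t)) (by norm_num) (by norm_num)
    rw [show (1 : ℝ) + (1 + t) = 1 + ((t + 1 : ℕ) : ℝ) by push_cast; ring] at h4
    have k1 := sum_sub_le (hDle (t + 1)) s (y - 1)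
    have k2 := sum_sub_le (hDle (t + 1)) s (y + 1)
    have k3 := sum_sub_le (hDle t) s y
    have k3' : D * (1 + t : ℝ) ^ (-(9 / 8) : ℝ) ≤ D * (4 * ρ) := by gcongr
    calc _ ≤ ∑ x ∈ s, 32 * ‖v‖ ^ 5 * (243 * (|waveKernel ‖a‖ (t + 1) (x - (y - 1))| ^ 5 +
            |waveKernel ‖a‖ (t + 1) (x - (y + 1))| ^ 5 + |waveKernel ‖a‖ t (x - y)| ^ 5)) := by
          refine Finset.sum_le_sum fun x _ => ?_
          refine (pow_le_pow_left₀ (norm_nonneg _)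
            (norm_linearWalk_pow_single_le hab ha₀ ha₁ y v t x) 5).trans ?_
          rw [mul_pow, mul_pow]
          norm_num only
          gcongr
          exact add_add_pow_five_le (abs_nonneg _) (abs_nonneg _) (abs_nonneg _)
      _ = 32 * ‖v‖ ^ 5 * (243 * (∑ x ∈ s, |waveKernel ‖a‖ (t + 1) (x - (y - 1))| ^ 5 +
            ∑ x ∈ s, |waveKernel ‖a‖ (t + 1) (x - (y + 1))| ^ 5 +
            ∑ x ∈ s, |waveKernel ‖a‖ t (x - y)| ^ 5)) := by
          rw [← Finset.mul_sum, ← Finset.mul_sum, Finset.sum_add_distrib, Finset.sum_add_distrib]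
      _ ≤ 32 * ‖v‖ ^ 5 * (243 * (D * ρ + D * ρ + D * (4 * ρ))) := by
          gcongr
          exact k3.trans k3'
      _ = 32 * 243 * (6 * D) * ρ * ‖v‖ ^ 5 := by ring
      _ ≤ _ := by
          gcongr
          linarith

/-- `l¹`–`l⁵` decay of the linear walk. -/
lemma exists_inclusionL5_le (ha₀ : 0 < ‖a‖) (ha₁ : ‖a‖ < 1) :
    ∃ D : ℝ, 0 < D ∧ ∀ (t : ℕ) (u : State), Summable (fun x => ‖u x‖) →
      ‖inclusionL5 ((linearWalk a b hab ^ t) u)‖ ≤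
        D * (1 + t : ℝ) ^ (-(9 / 40) : ℝ) * ∑' x, ‖u x‖ := by
  obtain ⟨D, hD, hDle⟩ := exists_inclusionL5_single_le hab ha₀ ha₁
  refine ⟨D, hD, fun t u hu => ?_⟩
  -- Superposition of point sources, each with the same decay rate.
  have h1 : HasSum (fun y => lp.single 2 y (u y)) u := lp.hasSum_single (by norm_num) u
  have h2 := (inclusionL5.comp
    ((linearWalk a b hab ^ t).toContinuousLinearEquiv : State →L[ℂ] State)).hasSum h1
  exact h2.norm_le_of_bounded (hu.hasSum.mul_left _) fun y => hDle t y (u y)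

end Decay5

/-! ### A discrete Hardy–Littlewood–Sobolev inequality -/

lemma sum_range_rpow_le (N : ℕ) :
    ∑ n ∈ Finset.range N, (1 + n : ℝ) ^ (-(1 / 3) : ℝ) ≤ 3 / 2 * (N : ℝ) ^ (2 / 3 : ℝ) := by
  induction N with
  | zero => simp
  | succ N ih =>
    rw [Finset.sum_range_succ]
    have hM : (0 : ℝ) < 1 + N := by positivity
    -- Weighted AM–GM gives N^{2/3}(1+N)^{1/3} ≤ N + 1/3, which says that the increment of N^{2/3}
    -- is at least (2/3)(1+N)^{-1/3}.
    have h1 := Real.geom_mean_le_arith_mean2_weighted (w₁ := 2 / 3) (w₂ := 1 / 3)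
      (p₁ := (N : ℝ)) (p₂ := 1 + N) (by norm_num) (by norm_num) (by positivity) hM.le
      (by norm_num)
    have e1 : (1 + N : ℝ) ^ (1 / 3 : ℝ) * (1 + N : ℝ) ^ (-(1 / 3) : ℝ) = 1 := by
      rw [← Real.rpow_add hM]
      norm_num
    have e2 : (1 + N : ℝ) * (1 + N : ℝ) ^ (-(1 / 3) : ℝ) = (1 + N : ℝ) ^ (2 / 3 : ℝ) := by
      nth_rewrite 1 [← Real.rpow_one (1 + N : ℝ)]
      rw [← Real.rpow_add hM]
      norm_num
    have h2 := mul_le_mul_of_nonneg_right h1 (Real.rpow_pos_of_pos hM (-(1 / 3))).le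
    rw [mul_assoc, e1, mul_one] at h2
    have e3 : ((N + 1 : ℕ) : ℝ) = 1 + N := by
      push_cast
      ring
    rw [e3, ← e2]
    nlinarith [Real.rpow_pos_of_pos hM (-(1 / 3))]

/-- The part of the kernel below the cut-off, measured in l¹. Writing the cut-off as ρ⁶ keeps the
later exponents integral. -/
lemma sum_near_le {ρ : ℝ} (hρ : 1 ≤ ρ) (S : Finset ℕ) :
    ∑ n ∈ S, (if (n : ℝ) ≤ ρ ^ 6 then (1 + n : ℝ) ^ (-(1 / 3) : ℝ) else 0) ≤ 3 * ρ ^ 4 := by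
  have hR : 1 ≤ ρ ^ 6 := one_le_pow₀ hρ
  have hρ0 : 0 ≤ ρ := by linarith
  rw [← Finset.sum_filter]
  have hsub : (S.filter fun n : ℕ => (n : ℝ) ≤ ρ ^ 6) ⊆ Finset.range (⌊ρ ^ 6⌋₊ + 1) := by
    intro n hn
    rw [Finset.mem_range, Nat.lt_succ_iff]
    exact Nat.le_floor (Finset.mem_filter.1 hn).2
  refine (Finset.sum_le_sum_of_subset_of_nonneg hsub fun _ _ _ => by positivity).trans ?_
  refine (sum_range_rpow_le _).trans ?_
  have h1 : ((⌊ρ ^ 6⌋₊ + 1 : ℕ) : ℝ) ≤ 2 * ρ ^ 6 := by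
    have := Nat.floor_le (show 0 ≤ ρ ^ 6 by positivity)
    push_cast
    linarith
  have h2 : ((⌊ρ ^ 6⌋₊ + 1 : ℕ) : ℝ) ^ (2 / 3 : ℝ) ≤ 2 * ρ ^ 4 := by
    refine (Real.rpow_le_rpow (by positivity) h1 (by norm_num)).trans ?_
    rw [Real.mul_rpow (by norm_num) (by positivity)]
    have e : (ρ ^ 6) ^ (2 / 3 : ℝ) = ρ ^ 4 := by
      rw [← Real.rpow_natCast, ← Real.rpow_mul hρ0, ← Real.rpow_natCast]
      norm_num
    rw [e]
    gcongr
    calc (2 : ℝ) ^ (2 / 3 : ℝ) ≤ 2 ^ (1 : ℝ) :=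
          Real.rpow_le_rpow_of_exponent_le one_le_two (by norm_num)
      _ = 2 := Real.rpow_one 2
  linarith

/-- The summand is the sixth power of the kernel's tail, as needed for Hölder's inequality with
exponents 6 and 6/5. -/
lemma sum_far_le {ρ : ℝ} (hρ : 1 ≤ ρ) (S : Finset ℕ) :
    ∑ n ∈ S, (if (n : ℝ) ≤ ρ ^ 6 then 0 else (1 + n : ℝ) ^ (-2 : ℝ)) ≤ 2 * (ρ⁻¹) ^ 6 := by
  have hR : 1 ≤ ρ ^ 6 := one_le_pow₀ hρ
  have hk : 1 ≤ ⌊ρ ^ 6⌋₊ := Nat.le_floor (by exact_mod_cast hR)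
  have hk' : (1 : ℝ) ≤ ⌊ρ ^ 6⌋₊ := by exact_mod_cast hk
  obtain ⟨M, hM⟩ : ∃ M : ℕ, ∀ n ∈ S, n ≤ M := ⟨S.sup id, fun n hn => Finset.le_sup (f := id) hn⟩
  have h1 : ∑ n ∈ S, (if (n : ℝ) ≤ ρ ^ 6 then 0 else (1 + n : ℝ) ^ (-2 : ℝ)) ≤
      ∑ n ∈ Finset.Ioc ⌊ρ ^ 6⌋₊ (max ⌊ρ ^ 6⌋₊ M), ((n : ℝ) ^ 2)⁻¹ := by
    have e : ∀ n : ℕ, (if (n : ℝ) ≤ ρ ^ 6 then 0 else (1 + n : ℝ) ^ (-2 : ℝ)) =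
        if ¬ (n : ℝ) ≤ ρ ^ 6 then (1 + n : ℝ) ^ (-2 : ℝ) else 0 := fun n => by
      rw [ite_not]
    simp only [e]
    rw [← Finset.sum_filter]
    have hsub : (S.filter fun n : ℕ => ¬ (n : ℝ) ≤ ρ ^ 6) ⊆
        Finset.Ioc ⌊ρ ^ 6⌋₊ (max ⌊ρ ^ 6⌋₊ M) := by
      intro n hn
      rw [Finset.mem_filter, not_le] at hn
      rw [Finset.mem_Ioc]
      exact ⟨(Nat.floor_lt (by positivity)).2 hn.2, (hM n hn.1).trans (le_max_right _ _)⟩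
    refine (Finset.sum_le_sum_of_subset_of_nonneg hsub fun _ _ _ => by positivity).trans ?_
    refine Finset.sum_le_sum fun n hn => ?_
    have hn1 : (1 : ℝ) ≤ n := by
      exact_mod_cast hk.trans (Finset.mem_Ioc.1 hn).1.le
    rw [Real.rpow_neg (by positivity), Real.rpow_two]
    refine inv_anti₀ (by positivity) ?_
    gcongr
    linarith
  refine h1.trans ((sum_Ioc_inv_sq_le_sub (by omega) (le_max_left _ _)).trans ?_)
  have h2 : (⌊ρ ^ 6⌋₊ : ℝ)⁻¹ ≤ 2 * (ρ⁻¹) ^ 6 := by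
    rw [inv_pow, ← div_eq_mul_inv, inv_eq_one_div, div_le_div_iff₀ (by linarith) (by linarith)]
    have := Nat.lt_floor_add_one (ρ ^ 6)
    linarith
  have h3 : (0 : ℝ) ≤ ((max ⌊ρ ^ 6⌋₊ M : ℕ) : ℝ)⁻¹ := by positivity
  linarith

/-- Each distance from t is attained at most once on either side of t. -/
lemma sum_dist_le {F : ℕ → ℝ} {B : ℝ} (hF : ∀ S : Finset ℕ, ∑ n ∈ S, F n ≤ B) (S : Finset ℕ)
    (t : ℕ) : ∑ s ∈ S, F (Nat.dist t s) ≤ 2 * B := by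
  rw [← Finset.sum_filter_add_sum_filter_not S (fun s => s ≤ t), two_mul]
  refine add_le_add ?_ ?_
  · refine le_trans (le_of_eq ?_) (hF ((S.filter fun s => s ≤ t).image (Nat.dist t)))
    rw [Finset.sum_image]
    intro x hx y hy h
    have := (Finset.mem_filter.1 hx).2
    have := (Finset.mem_filter.1 hy).2
    simp only [Nat.dist] at h
    omega
  · refine le_trans (le_of_eq ?_) (hF ((S.filter fun s => ¬ s ≤ t).image (Nat.dist t)))
    rw [Finset.sum_image]
    intro x hx y hy h
    have := (Finset.mem_filter.1 hx).2
    have := (Finset.mem_filter.1 hy).2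
    simp only [Nat.dist] at h
    omega

/-- The kernel `(1 + |t - s|)^{-1/3}`. -/
noncomputable def decayKernel (t s : ℕ) : ℝ := (1 + (Nat.dist t s : ℝ)) ^ (-(1 / 3) : ℝ)

lemma decayKernel_nonneg (t s : ℕ) : 0 ≤ decayKernel t s := by
  unfold decayKernel
  positivity

lemma decayKernel_comm (t s : ℕ) : decayKernel t s = decayKernel s t := by
  rw [decayKernel, Nat.dist_comm, decayKernel]

/-- The kernel is cut at distance ρ⁶ with ρ = X / g t. Near t, the restriction g s ≤ g t gives a
multiple of ρ⁴ (g t)⁵; far from t, Hölder gives a multiple of ρ⁻¹ X⁵. This ρ makes both equal to g t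
· X⁴. -/
lemma sum_decayKernel_mul_le {g : ℕ → ℝ} {X : ℝ} {T t : ℕ} (hg : ∀ t, 0 ≤ g t) (hX : 0 ≤ X)
    (hgX : ∑ s ∈ Finset.range T, g s ^ 6 = X ^ 6) (ht : t < T) :
    ∑ s ∈ (Finset.range T).filter (fun s => g s ≤ g t), decayKernel t s * g s ^ 5 ≤
      8 * (g t * X ^ 4) := by
  rcases (hg t).eq_or_lt with h0 | hpos
  · rw [← h0, zero_mul, mul_zero]
    refine (Finset.sum_eq_zero fun s hs => ?_).le
    have : g s = 0 := le_antisymm (h0 ▸ (Finset.mem_filter.1 hs).2) (hg s)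
    simp [this]
  set S := (Finset.range T).filter (fun s => g s ≤ g t) with hS
  have htX : g t ≤ X := by
    have h1 : g t ^ 6 ≤ X ^ 6 := by
      rw [← hgX]
      exact Finset.single_le_sum (f := fun s => g s ^ 6) (fun s _ => by have := hg s; positivity)
        (Finset.mem_range.2 ht)
    exact (pow_le_pow_iff_left₀ (hg t) hX (by norm_num)).1 h1
  have hX0 : 0 < X := hpos.trans_le htX
  set ρ := X / g t with hρ
  have hρ1 : 1 ≤ ρ := (one_le_div hpos).2 htX
  have hρX : g t * ρ = X := by
    rw [hρ]
    field_simp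
  set F₁ : ℕ → ℝ := fun n => if (n : ℝ) ≤ ρ ^ 6 then (1 + n : ℝ) ^ (-(1 / 3) : ℝ) else 0 with hF₁
  set F₂ : ℕ → ℝ := fun n => if (n : ℝ) ≤ ρ ^ 6 then 0 else (1 + n : ℝ) ^ (-(1 / 3) : ℝ) with hF₂
  have hF₂0 : ∀ n, 0 ≤ F₂ n := fun n => by
    rw [hF₂]
    dsimp only
    split_ifs
    · exact le_rfl
    · positivity
  have hF₁0 : ∀ n, 0 ≤ F₁ n := fun n => by
    rw [hF₁]
    dsimp only
    split_ifs
    · positivity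
    · exact le_rfl
  have hsplit : ∀ s, decayKernel t s = F₁ (Nat.dist t s) + F₂ (Nat.dist t s) := fun s => by
    simp only [decayKernel, hF₁, hF₂]
    split_ifs <;> simp
  have near : ∑ s ∈ S, F₁ (Nat.dist t s) * g s ^ 5 ≤ 6 * (g t * X ^ 4) := by
    calc _ ≤ ∑ s ∈ S, F₁ (Nat.dist t s) * g t ^ 5 := by
          refine Finset.sum_le_sum fun s hs => mul_le_mul_of_nonneg_left ?_ (hF₁0 _)
          exact pow_le_pow_left₀ (hg s) (Finset.mem_filter.1 hs).2 5
      _ = (∑ s ∈ S, F₁ (Nat.dist t s)) * g t ^ 5 := by rw [Finset.sum_mul]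
      _ ≤ 2 * (3 * ρ ^ 4) * g t ^ 5 := by
          gcongr
          exact sum_dist_le (sum_near_le hρ1) S t
      _ = 6 * (g t * (g t * ρ) ^ 4) := by ring
      _ = _ := by rw [hρX]
  have far : ∑ s ∈ S, F₂ (Nat.dist t s) * g s ^ 5 ≤ 2 * (g t * X ^ 4) := by
    have h1 := Real.inner_le_Lp_mul_Lq_of_nonneg S (f := fun s => F₂ (Nat.dist t s))
      (g := fun s => g s ^ 5) (p := 6) (q := 6 / 5)
      (by rw [Real.holderConjugate_iff]; norm_num)
      (fun s _ => hF₂0 _) (fun s _ => by have := hg s; positivity)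
    refine h1.trans ?_
    have h2 : ∑ s ∈ S, F₂ (Nat.dist t s) ^ (6 : ℝ) ≤ (2 * ρ⁻¹) ^ 6 := by
      have e : ∀ n : ℕ, F₂ n ^ (6 : ℝ) = if (n : ℝ) ≤ ρ ^ 6 then 0 else (1 + n : ℝ) ^ (-2 : ℝ) :=
        fun n => by
          rw [hF₂]
          dsimp only
          split_ifs
          · exact Real.zero_rpow (by norm_num)
          · rw [← Real.rpow_mul (by positivity)]
            norm_num
      simp only [e]
      refine (sum_dist_le (sum_far_le hρ1) S t).trans ?_
      rw [mul_pow]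
      have : 0 ≤ (ρ⁻¹) ^ 6 := by positivity
      linarith
    have h3 : ∑ s ∈ S, (g s ^ 5) ^ (6 / 5 : ℝ) ≤ X ^ 6 := by
      have e : ∀ s, (g s ^ 5) ^ (6 / 5 : ℝ) = g s ^ 6 := fun s => by
        rw [← Real.rpow_natCast, ← Real.rpow_mul (hg s), ← Real.rpow_natCast]
        norm_num
      simp only [e]
      rw [← hgX]
      exact Finset.sum_le_sum_of_subset_of_nonneg (Finset.filter_subset _ _)
        fun s _ _ => by have := hg s; positivity
    have h4 : (∑ s ∈ S, F₂ (Nat.dist t s) ^ (6 : ℝ)) ^ (1 / 6 : ℝ) ≤ 2 * ρ⁻¹ := by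
      refine (Real.rpow_le_rpow (Finset.sum_nonneg fun s _ => by
        have := hF₂0 (Nat.dist t s); positivity) h2 (by norm_num)).trans_eq ?_
      rw [← Real.rpow_natCast, ← Real.rpow_mul (by positivity)]
      norm_num
    have h5 : (∑ s ∈ S, (g s ^ 5) ^ (6 / 5 : ℝ)) ^ (1 / (6 / 5) : ℝ) ≤ X ^ 5 := by
      refine (Real.rpow_le_rpow (Finset.sum_nonneg fun s _ => by
        have := hg s; positivity) h3 (by norm_num)).trans_eq ?_
      rw [← Real.rpow_natCast, ← Real.rpow_mul hX, ← Real.rpow_natCast]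
      norm_num
    calc _ ≤ 2 * ρ⁻¹ * X ^ 5 := mul_le_mul h4 h5 (Real.rpow_nonneg
          (Finset.sum_nonneg fun s _ => by have := hg s; positivity) _) (by positivity)
      _ = 2 * (g t * X ^ 4) := by
          rw [hρ]
          field_simp
  simp only [hsplit, add_mul, Finset.sum_add_distrib]
  linarith

/-- Discrete Hardy–Littlewood–Sobolev inequality for the kernel `(1 + |t - s|)^{-1/3}`. -/
lemma sum_sum_decayKernel_le {g : ℕ → ℝ} {X : ℝ} {T : ℕ} (hg : ∀ t, 0 ≤ g t) (hX : 0 ≤ X)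
    (hgX : ∑ s ∈ Finset.range T, g s ^ 6 = X ^ 6) :
    ∑ t ∈ Finset.range T, ∑ s ∈ Finset.range T, decayKernel t s * (g t ^ 5 * g s ^ 5) ≤
      16 * X ^ 10 := by
  have hnn : ∀ t s, 0 ≤ decayKernel t s * (g t ^ 5 * g s ^ 5) := fun t s =>
    mul_nonneg (decayKernel_nonneg t s) (mul_nonneg (pow_nonneg (hg t) 5) (pow_nonneg (hg s) 5))
  -- By symmetry of the kernel it suffices to sum over pairs with g s ≤ g t.
  have half : ∑ t ∈ Finset.range T, ∑ s ∈ Finset.range T,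
      (if g s ≤ g t then decayKernel t s * (g t ^ 5 * g s ^ 5) else 0) ≤ 8 * X ^ 10 := by
    calc _ ≤ ∑ t ∈ Finset.range T, 8 * X ^ 4 * g t ^ 6 := by
          refine Finset.sum_le_sum fun t ht => ?_
          rw [← Finset.sum_filter]
          have h := sum_decayKernel_mul_le hg hX hgX (Finset.mem_range.1 ht)
          calc _ = g t ^ 5 * ∑ s ∈ (Finset.range T).filter (fun s => g s ≤ g t),
                  decayKernel t s * g s ^ 5 := by
                rw [Finset.mul_sum]
                exact Finset.sum_congr rfl fun s _ => by ring
            _ ≤ g t ^ 5 * (8 * (g t * X ^ 4)) :=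
                mul_le_mul_of_nonneg_left h (pow_nonneg (hg t) 5)
            _ = _ := by ring
      _ = 8 * X ^ 10 := by
          rw [← Finset.mul_sum, hgX]
          ring
  calc _ ≤ ∑ t ∈ Finset.range T, ∑ s ∈ Finset.range T,
        ((if g s ≤ g t then decayKernel t s * (g t ^ 5 * g s ^ 5) else 0) +
          (if g t ≤ g s then decayKernel s t * (g s ^ 5 * g t ^ 5) else 0)) := by
        refine Finset.sum_le_sum fun t _ => Finset.sum_le_sum fun s _ => ?_
        have h1 := hnn t s
        rw [decayKernel_comm s t, mul_comm (g s ^ 5)]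
        rcases le_total (g s) (g t) with h | h
        · rw [if_pos h]
          split_ifs <;> linarith
        · rw [if_pos h]
          split_ifs <;> linarith
    _ ≤ 8 * X ^ 10 + 8 * X ^ 10 := by
        simp only [Finset.sum_add_distrib]
        refine add_le_add half ?_
        rw [Finset.sum_comm]
        exact half
    _ = _ := by ring

/-! ### The Strichartz estimate -/

section Strichartz

variable {a b : ℂ} (hab : ‖a‖ ^ 2 + ‖b‖ ^ 2 = 1)

lemma linearWalk_pow_symm (t s : ℕ) (h : s ≤ t) (u : State) :
    (linearWalk a b hab ^ t) ((linearWalk a b hab ^ s).symm u) =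
      (linearWalk a b hab ^ (t - s)) u := by
  conv_lhs => rw [← Nat.sub_add_cancel h, pow_add]
  change (linearWalk a b hab ^ (t - s)) ((linearWalk a b hab ^ s) _) = _
  rw [LinearIsometryEquiv.apply_symm_apply]

/-- The matrix entries of TT*: moving both sources forward by the later time leaves one value of
U₀^(t-s) applied to a point source, which the dispersive estimate controls. -/
lemma norm_inner_symm_single_le {D : ℝ} (hD : ∀ (t : ℕ) (x y : ℤ) (v : EuclideanSpace ℂ (Fin 2)),
      ‖(linearWalk a b hab ^ t) (lp.single 2 y v) x‖ ≤ D * (1 + t : ℝ) ^ (-(1 / 3) : ℝ) * ‖v‖)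
    (t s : ℕ) (x y : ℤ) {v w : EuclideanSpace ℂ (Fin 2)} (hv : ‖v‖ ≤ 1) (hw : ‖w‖ ≤ 1)
    (hD0 : 0 ≤ D) :
    ‖(inner ℂ ((linearWalk a b hab ^ t).symm (lp.single 2 x v))
      ((linearWalk a b hab ^ s).symm (lp.single 2 y w)) : ℂ)‖ ≤ D * decayKernel t s := by
  wlog h : s ≤ t generalizing t s x y v w
  · rw [norm_inner_symm, decayKernel_comm]
    exact this s t y x hw hv (le_of_not_ge h)
  rw [← LinearIsometryEquiv.inner_map_map (linearWalk a b hab ^ t),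
    LinearIsometryEquiv.apply_symm_apply, linearWalk_pow_symm hab t s h, lp.inner_single_left]
  have e : decayKernel t s = (1 + ((t - s : ℕ) : ℝ)) ^ (-(1 / 3) : ℝ) := by
    rw [decayKernel, Nat.dist_eq_sub_of_le_right h]
  rw [e]
  have h0 : (0 : ℝ) ≤ (1 + ((t - s : ℕ) : ℝ)) ^ (-(1 / 3) : ℝ) := by positivity
  calc _ ≤ ‖v‖ * ‖(linearWalk a b hab ^ (t - s)) (lp.single 2 y w) x‖ := norm_inner_le_norm _ _
    _ ≤ 1 * (D * (1 + ((t - s : ℕ) : ℝ)) ^ (-(1 / 3) : ℝ) * 1) := by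
        gcongr
        exact (hD (t - s) x y w).trans (by gcongr)
    _ = _ := by ring

/-- Dual form of the `l⁶_t l^∞_x` Strichartz estimate. -/
lemma exists_strichartz (ha₀ : 0 < ‖a‖) (ha₁ : ‖a‖ < 1) :
    ∃ D : ℝ, 0 < D ∧ ∀ (T : ℕ) (x : ℕ → ℤ) (g : ℕ → ℝ) (X : ℝ) (u : State),
      (∀ t, 0 ≤ g t) → 0 ≤ X → ∑ t ∈ Finset.range T, g t ^ 6 = X ^ 6 →
      ∑ t ∈ Finset.range T, g t ^ 5 * ‖(linearWalk a b hab ^ t) u (x t)‖ ≤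
        D * X ^ 5 * ‖u‖ := by
  obtain ⟨D, hD0, hD⟩ := exists_norm_linearWalk_pow_single_le hab ha₀ ha₁
  refine ⟨√(16 * D), by positivity, fun T x g X u hg hX hgX => ?_⟩
  set w : ℕ → EuclideanSpace ℂ (Fin 2) := fun t => (linearWalk a b hab ^ t) u (x t) with hw
  -- The unit vector dual to w t, and 0 when w t = 0 because the inverse of 0 is 0.
  set v : ℕ → EuclideanSpace ℂ (Fin 2) := fun t => ((‖w t‖⁻¹ : ℝ) : ℂ) • w t with hv
  have hv1 : ∀ t, ‖v t‖ ≤ 1 := fun t => by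
    rw [hv]
    dsimp only
    rw [norm_smul, Complex.norm_real, norm_inv, norm_norm]
    exact inv_mul_le_one
  have hvw : ∀ t, (inner ℂ (v t) (w t) : ℂ) = ‖w t‖ := fun t => by
    rw [hv]
    dsimp only
    rw [inner_smul_left, Complex.conj_ofReal, inner_self_eq_norm_sq_to_K]
    rcases eq_or_ne (‖w t‖) 0 with h | h
    · simp [h]
    · have : (‖w t‖ : ℂ) ≠ 0 := by exact_mod_cast h
      push_cast
      field_simp
      simp
  set ψ : ℕ → State := fun t => (linearWalk a b hab ^ t).symm (lp.single 2 (x t) (v t)) with hψ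
  -- Pairing Ψ with u gives the left-hand side, and ‖Ψ‖² expands into the double sum of the
  -- Hardy–Littlewood–Sobolev inequality. The weights g⁵ are those dual to l⁶.
  set Ψ : State := ∑ t ∈ Finset.range T, ((g t ^ 5 : ℝ) : ℂ) • ψ t with hΨ
  have h1 : (inner ℂ Ψ u : ℂ) =
      ((∑ t ∈ Finset.range T, g t ^ 5 * ‖w t‖ : ℝ) : ℂ) := by
    rw [hΨ, sum_inner, Complex.ofReal_sum]
    refine Finset.sum_congr rfl fun t _ => ?_
    rw [inner_smul_left, Complex.conj_ofReal, hψ]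
    dsimp only
    rw [← LinearIsometryEquiv.inner_map_map (linearWalk a b hab ^ t),
      LinearIsometryEquiv.apply_symm_apply, lp.inner_single_left, Complex.ofReal_mul]
    congr 1
    exact hvw t
  have h2 : ‖Ψ‖ ^ 2 ≤ 16 * D * X ^ 10 := by
    have e : ‖Ψ‖ ^ 2 = ‖(inner ℂ Ψ Ψ : ℂ)‖ := by
      rw [inner_self_eq_norm_sq_to_K]
      simp
    rw [e]
    nth_rewrite 1 [hΨ]
    rw [sum_inner]
    calc _ ≤ ∑ t ∈ Finset.range T, ∑ s ∈ Finset.range T,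
          D * (decayKernel t s * (g t ^ 5 * g s ^ 5)) := by
          refine norm_sum_le_of_le _ fun t _ => ?_
          rw [hΨ, inner_sum]
          refine norm_sum_le_of_le _ fun s _ => ?_
          rw [inner_smul_left, inner_smul_right, norm_mul, norm_mul, Complex.conj_ofReal,
            Complex.norm_real, Complex.norm_real, Real.norm_of_nonneg (pow_nonneg (hg t) 5),
            Real.norm_of_nonneg (pow_nonneg (hg s) 5)]
          have h3 := norm_inner_symm_single_le hab hD t s (x t) (x s) (hv1 t) (hv1 s) hD0.le
          have h4 := pow_nonneg (hg t) 5
          have h5 := pow_nonneg (hg s) 5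
          calc _ ≤ g t ^ 5 * (g s ^ 5 * (D * decayKernel t s)) := by gcongr
            _ = _ := by ring
      _ ≤ D * (16 * X ^ 10) := by
          simp only [← Finset.mul_sum]
          gcongr
          exact sum_sum_decayKernel_le hg hX hgX
      _ = _ := by ring
  have h6 : ‖Ψ‖ ≤ √(16 * D) * X ^ 5 := by
    refine abs_le_of_sq_le_sq' ?_ (by positivity) |>.2
    rw [mul_pow, Real.sq_sqrt (by positivity)]
    exact h2.trans_eq (by ring)
  have h7 : 0 ≤ ∑ t ∈ Finset.range T, g t ^ 5 * ‖w t‖ :=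
    Finset.sum_nonneg fun t _ => mul_nonneg (pow_nonneg (hg t) 5) (norm_nonneg _)
  calc _ = ‖(inner ℂ Ψ u : ℂ)‖ := by
        rw [h1, Complex.norm_real, Real.norm_of_nonneg h7]
    _ ≤ ‖Ψ‖ * ‖u‖ := norm_inner_le_norm _ _
    _ ≤ _ := by gcongr

end Strichartz

/-! ### The nonlinear walk -/

/-- The nonlinear part `(C_N(|u₁|², |u₂|²) - 1) u`. -/
noncomputable def nonlinearity (CN : ℝ → ℝ → Matrix.unitaryGroup (Fin 2) ℂ) (u : State) : State :=
  coinOp CN u - u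

lemma exists_norm_nonlinearity_apply_le {CN : ℝ → ℝ → Matrix.unitaryGroup (Fin 2) ℂ} {m : ℕ}
    (h : NearIdentity CN m) :
    ∃ K : ℝ, 0 ≤ K ∧ ∀ (u : State) (x : ℤ),
      ‖nonlinearity CN u x‖ ≤ K * ‖u x‖ ^ (2 * m) * ‖u x‖ := by
  obtain ⟨-, K, hK⟩ := h
  refine ⟨|K|, abs_nonneg K, fun u x => ?_⟩
  have h1 := (hK (‖u x 0‖ ^ 2) (‖u x 1‖ ^ 2) (sq_nonneg _) (sq_nonneg _)).1
  rw [← norm_sq_euclidean, ← pow_mul] at h1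
  set A : Matrix (Fin 2) (Fin 2) ℂ := (CN (‖u x 0‖ ^ 2) (‖u x 1‖ ^ 2) : Matrix (Fin 2) (Fin 2) ℂ)
    with hA
  have e : nonlinearity CN u x = Matrix.toEuclideanCLM (n := Fin 2) (𝕜 := ℂ) (A - 1) (u x) := by
    rw [map_sub, map_one]
    rfl
  rw [e]
  refine (ContinuousLinearMap.le_opNorm _ _).trans ?_
  gcongr
  rw [Matrix.l2_opNorm_toEuclideanCLM]
  refine h1.trans ?_
  gcongr
  exact le_abs_self K

lemma norm_le_of_forall_norm_le {u v : State} {c : ℝ} (hc : 0 ≤ c)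
    (h : ∀ x, ‖v x‖ ≤ c * ‖u x‖) : ‖v‖ ≤ c * ‖u‖ := by
  refine abs_le_of_sq_le_sq' ?_ (by positivity) |>.2
  rw [mul_pow, norm_sq_eq_tsum, norm_sq_eq_tsum, ← tsum_mul_left]
  refine (summable_norm_sq v).tsum_le_tsum (fun x => ?_) ((summable_norm_sq u).mul_left _)
  rw [← mul_pow]
  exact pow_le_pow_left₀ (norm_nonneg _) (h x) 2

/-- Square-summability makes ‖u x‖ tend to 0 at infinity, so the supremum is attained. The l^∞ norm
thereby becomes a value at a chosen site, as the dual Strichartz estimate requires. -/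
lemma exists_forall_norm_apply_le (u : State) : ∃ x, ∀ y, ‖u y‖ ≤ ‖u x‖ := by
  have h := (summable_norm_sq u).tendsto_cofinite_zero
  by_cases h0 : ∃ z, 0 < ‖u z‖
  · obtain ⟨z, hz⟩ := h0
    have hfin : {x | ¬ ‖u x‖ ^ 2 < ‖u z‖ ^ 2}.Finite :=
      h.eventually (gt_mem_nhds (by positivity : 0 < ‖u z‖ ^ 2))
    have hzmem : z ∈ {x | ¬ ‖u x‖ ^ 2 < ‖u z‖ ^ 2} := lt_irrefl (‖u z‖ ^ 2)
    obtain ⟨x, hx, hmax⟩ := Set.exists_max_image _ (fun x => ‖u x‖) hfin ⟨z, hzmem⟩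
    refine ⟨x, fun y => ?_⟩
    by_cases hy : y ∈ {x | ¬ ‖u x‖ ^ 2 < ‖u z‖ ^ 2}
    · exact hmax y hy
    · have hy' : ‖u y‖ ^ 2 < ‖u z‖ ^ 2 := not_not.1 hy
      exact ((pow_lt_pow_iff_left₀ (norm_nonneg _) (norm_nonneg _) two_ne_zero).1 hy').le.trans
        (hmax z hzmem)
  · push Not at h0
    exact ⟨0, fun y => (h0 y).trans (norm_nonneg _)⟩

lemma norm_le_tsum_norm (u : State) (hu : Summable fun x => ‖u x‖) : ‖u‖ ≤ ∑' x, ‖u x‖ :=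
  (lp.hasSum_single (E := fun _ : ℤ => EuclideanSpace ℂ (Fin 2)) (p := 2)
    (by norm_num) u).norm_le_of_bounded hu.hasSum fun y => (norm_single y (u y)).le

/-! ### Duhamel's formula and small data in l² -/

section Duhamel

variable {a b : ℂ} (hab : ‖a‖ ^ 2 + ‖b‖ ^ 2 = 1) (CN : ℝ → ℝ → Matrix.unitaryGroup (Fin 2) ℂ)

/-- The solution of the nonlinear walk. -/
noncomputable def solution (u₀ : State) (t : ℕ) : State :=
  evolution (fun s₁ s₂ => constCoin a b hab * CN s₁ s₂) t u₀

/-- The nonlinear term at time `t`, pulled back to time `0` by the linear walk. -/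
noncomputable def pulledBackTerm (u₀ : State) (t : ℕ) : State :=
  (linearWalk a b hab ^ t).symm (nonlinearity CN (solution hab CN u₀ t))

lemma norm_pulledBackTerm (u₀ : State) (t : ℕ) :
    ‖pulledBackTerm hab CN u₀ t‖ = ‖nonlinearity CN (solution hab CN u₀ t)‖ :=
  LinearIsometryEquiv.norm_map _ _

lemma solution_succ (u₀ : State) (t : ℕ) : solution hab CN u₀ (t + 1) =
    linearWalk a b hab (solution hab CN u₀ t + nonlinearity CN (solution hab CN u₀ t)) := by
  rw [nonlinearity, add_sub_cancel, linearWalk_apply]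
  change step _ (solution hab CN u₀ t) = _
  rw [step, step]
  congr 1
  refine lp.ext (funext fun x => ?_)
  rw [coinOp_apply, coinOp_apply, coinOp_apply, ← mul_apply_eq_comp, ← map_mul,
    ← Submonoid.coe_mul]

/-- Duhamel's formula. -/
lemma solution_eq (u₀ : State) (t : ℕ) : solution hab CN u₀ t =
    (linearWalk a b hab ^ t) (u₀ + ∑ s ∈ Finset.range t, pulledBackTerm hab CN u₀ s) := by
  induction t with
  | zero =>
    rw [Finset.sum_range_zero, add_zero]
    rfl
  | succ t ih =>
    rw [solution_succ, Finset.sum_range_succ, ← add_assoc, linearWalk_pow_succ_apply,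
      map_add (linearWalk a b hab ^ t), ← ih, pulledBackTerm,
      LinearIsometryEquiv.apply_symm_apply]

lemma solution_apply (u₀ : State) (t : ℕ) (x : ℤ) : solution hab CN u₀ t x =
    (linearWalk a b hab ^ t) u₀ x +
      ∑ s ∈ Finset.range t, (linearWalk a b hab ^ t) (pulledBackTerm hab CN u₀ s) x := by
  rw [solution_eq, map_add, map_sum]
  change _ + (↑(∑ s ∈ Finset.range t,
    (linearWalk a b hab ^ t) (pulledBackTerm hab CN u₀ s)) : ∀ _ : ℤ, _) x = _
  rw [lp.coeFn_sum, Finset.sum_apply]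

/-- Unitarity of U₀ᵗ reduces the distance to U₀ᵗu₊ to the tail of the series of pulled-back terms,
which converges absolutely. -/
lemma scatters_of_summable (u₀ : State)
    (h : Summable fun t => ‖nonlinearity CN (solution hab CN u₀ t)‖) :
    Scatters (constCoin a b hab) (fun s₁ s₂ => constCoin a b hab * CN s₁ s₂) u₀ := by
  have hs : Summable (pulledBackTerm hab CN u₀) := by
    refine Summable.of_norm ?_
    simpa only [norm_pulledBackTerm] using h
  refine ⟨u₀ + ∑' s, pulledBackTerm hab CN u₀ s, ?_⟩
  have h1 := tendsto_iff_norm_sub_tendsto_zero.1 (hs.hasSum.tendsto_sum_nat.const_add u₀)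
  refine h1.congr fun t => ?_
  rw [evolution_constCoin]
  change _ = ‖solution hab CN u₀ t - _‖
  rw [solution_eq, ← map_sub, LinearIsometryEquiv.norm_map]

/-- Scattering of small solutions in `l²` for nonlinearities of order seven. -/
theorem exists_scatters_l2 (ha₀ : 0 < ‖a‖) (ha₁ : ‖a‖ < 1) (h : NearIdentity CN 3) :
    ∃ δ : ℝ, 0 < δ ∧ ∀ u₀ : State, ‖u₀‖ < δ →
      Scatters (constCoin a b hab) (fun s₁ s₂ => constCoin a b hab * CN s₁ s₂) u₀ := by
  obtain ⟨K, hK0, hK⟩ := exists_norm_nonlinearity_apply_le h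
  obtain ⟨D, hD0, hD⟩ := exists_strichartz hab ha₀ ha₁
  -- In D(1 + K), the 1 pays for the free evolution and K for the nonlinear terms.
  refine ⟨(D * (1 + K))⁻¹, by positivity, fun u₀ hu₀ => ?_⟩
  set u := solution hab CN u₀ with hu
  choose x hx using fun t => exists_forall_norm_apply_le (u t)
  set g : ℕ → ℝ := fun t => ‖u t (x t)‖ with hg
  have hg0 : ∀ t, 0 ≤ g t := fun t => norm_nonneg _
  have hN : ∀ t, ‖nonlinearity CN (u t)‖ ≤ K * ‖u₀‖ * g t ^ 6 := fun t => by
    have h1 : ‖nonlinearity CN (u t)‖ ≤ K * g t ^ 6 * ‖u t‖ := by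
      refine norm_le_of_forall_norm_le (by positivity) fun y => (hK (u t) y).trans ?_
      gcongr
      exact hx t y
    have h2 : ‖u t‖ = ‖u₀‖ := norm_evolution _ t u₀
    rw [h2] at h1
    linarith
  -- The bootstrap closes by induction because the solution up to time T involves only sources at
  -- times s < T. With g itself as dual weight, Strichartz gives X⁶ ≤ X⁵, hence X ≤ 1.
  have hG : ∀ T, ∑ t ∈ Finset.range T, g t ^ 6 ≤ 1 := by
    intro T
    induction T with
    | zero => simp
    | succ T ih =>
      have hG0 : 0 ≤ ∑ t ∈ Finset.range (T + 1), g t ^ 6 :=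
        Finset.sum_nonneg fun t _ => pow_nonneg (hg0 t) 6
      obtain ⟨X, hX0, hX⟩ : ∃ X : ℝ, 0 ≤ X ∧ ∑ t ∈ Finset.range (T + 1), g t ^ 6 = X ^ 6 := by
        refine ⟨(∑ t ∈ Finset.range (T + 1), g t ^ 6) ^ ((6 : ℕ) : ℝ)⁻¹, by positivity, ?_⟩
        rw [Real.rpow_inv_natCast_pow hG0 (by norm_num)]
      have h1 : X ^ 6 ≤ D * X ^ 5 * ‖u₀‖ +
          ∑ s ∈ Finset.range T, D * X ^ 5 * ‖pulledBackTerm hab CN u₀ s‖ := by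
        calc X ^ 6 = ∑ t ∈ Finset.range (T + 1), g t ^ 5 * ‖u t (x t)‖ := by
              rw [← hX]
              exact Finset.sum_congr rfl fun t _ => pow_succ _ _
          _ ≤ ∑ t ∈ Finset.range (T + 1), (g t ^ 5 * ‖(linearWalk a b hab ^ t) u₀ (x t)‖ +
              ∑ s ∈ Finset.range T, g t ^ 5 *
                ‖(linearWalk a b hab ^ t) (pulledBackTerm hab CN u₀ s) (x t)‖) := by
              refine Finset.sum_le_sum fun t ht => ?_
              rw [← Finset.mul_sum, ← mul_add]
              refine mul_le_mul_of_nonneg_left ?_ (pow_nonneg (hg0 t) 5)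
              rw [hu, solution_apply]
              refine (norm_add_le _ _).trans (add_le_add_right ((norm_sum_le _ _).trans ?_) _)
              -- Norms are already inside the sum, so the retarded range s < t may be enlarged to s
              -- < T, and the homogeneous estimate then applies to each source separately.
              refine Finset.sum_le_sum_of_subset_of_nonneg ?_ fun _ _ _ => norm_nonneg _
              exact Finset.range_mono (Nat.lt_succ_iff.1 (Finset.mem_range.1 ht))
          _ ≤ _ := by
              rw [Finset.sum_add_distrib, Finset.sum_comm]
              refine add_le_add (hD _ x g X u₀ hg0 hX0 hX) ?_
              exact Finset.sum_le_sum fun s _ => hD _ x g X _ hg0 hX0 hX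
      have h2 : ∑ s ∈ Finset.range T, D * X ^ 5 * ‖pulledBackTerm hab CN u₀ s‖ ≤
          D * X ^ 5 * (K * ‖u₀‖) := by
        rw [← Finset.mul_sum]
        refine mul_le_mul_of_nonneg_left ?_ (by positivity)
        calc _ ≤ ∑ s ∈ Finset.range T, K * ‖u₀‖ * g s ^ 6 :=
              Finset.sum_le_sum fun s _ => by
                rw [norm_pulledBackTerm]
                exact hN s
          _ = K * ‖u₀‖ * ∑ s ∈ Finset.range T, g s ^ 6 := by rw [Finset.mul_sum]
          _ ≤ K * ‖u₀‖ * 1 := by gcongr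
          _ = _ := mul_one _
      have h3 : D * (1 + K) * ‖u₀‖ ≤ 1 := by
        have h4 := (mul_le_mul_of_nonneg_left hu₀.le (by positivity : 0 ≤ D * (1 + K)))
        rwa [mul_inv_cancel₀ (by positivity)] at h4
      have h5 : X ^ 6 ≤ X ^ 5 := by
        calc X ^ 6 ≤ X ^ 5 * (D * (1 + K) * ‖u₀‖) := by linarith
          _ ≤ X ^ 5 * 1 := by gcongr
          _ = _ := mul_one _
      rw [hX]
      refine pow_le_one₀ hX0 ?_
      by_contra hX1
      push Not at hX1
      have : X ^ 5 < X ^ 6 := pow_lt_pow_right₀ hX1 (by norm_num)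
      linarith
  refine scatters_of_summable hab CN u₀ ?_
  refine summable_of_sum_range_le (c := K * ‖u₀‖) (fun _ => norm_nonneg _) fun T => ?_
  calc _ ≤ ∑ t ∈ Finset.range T, K * ‖u₀‖ * g t ^ 6 := Finset.sum_le_sum fun t _ => hN t
    _ = K * ‖u₀‖ * ∑ t ∈ Finset.range T, g t ^ 6 := by rw [Finset.mul_sum]
    _ ≤ K * ‖u₀‖ * 1 := by
        gcongr
        exact hG T
    _ = _ := mul_one _

end Duhamel

/-! ### Summation of decay rates -/

/-- The decay rate `(1 + t)^{-9/40}`. -/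
noncomputable def decayRate (t : ℕ) : ℝ := (1 + t : ℝ) ^ (-(9 / 40) : ℝ)

lemma decayRate_pos (t : ℕ) : 0 < decayRate t := by
  unfold decayRate
  positivity

lemma summable_decayRate_pow_five : Summable fun t => decayRate t ^ 5 := by
  have h := (summable_nat_add_iff 1).2
    (Real.summable_nat_rpow.2 (by norm_num : (-(9 / 8) : ℝ) < -1))
  refine h.congr fun t => ?_
  rw [decayRate, ← Real.rpow_natCast, ← Real.rpow_mul (by positivity)]
  push_cast
  rw [add_comm]
  norm_num

lemma decayRate_le_two_mul {s t : ℕ} (h : 1 + t ≤ 2 * (1 + s)) :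
    decayRate s ≤ 2 * decayRate t := by
  have h' : (1 + t : ℝ) ≤ 2 * (1 + s) := by exact_mod_cast h
  have h2 : (2 : ℝ)⁻¹ ≤ 2 ^ (-(9 / 40) : ℝ) := by
    rw [← Real.rpow_neg_one]
    exact Real.rpow_le_rpow_of_exponent_le one_le_two (by norm_num)
  have h3 : (2 * (1 + s : ℝ)) ^ (-(9 / 40) : ℝ) ≤ (1 + t : ℝ) ^ (-(9 / 40) : ℝ) :=
    Real.rpow_le_rpow_of_nonpos (by positivity) h' (by norm_num)
  rw [Real.mul_rpow (by norm_num) (by positivity)] at h3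
  have h4 := decayRate_pos s
  have h5 := mul_le_mul_of_nonneg_right h2 h4.le
  unfold decayRate at *
  linarith

/-- The larger of s and t - s is about t/2 or more, so one factor of its rate is comparable to the
rate at t; the five remaining factors are at most the fifth power of the rate at the smaller time.
-/
lemma decayRate_mul_pow_five_le {s t : ℕ} (h : s < t) :
    decayRate (t - s) * decayRate s ^ 5 ≤
      2 * decayRate t * (decayRate s ^ 5 + decayRate (t - s) ^ 5) := by
  have hs := decayRate_pos s
  have hts := decayRate_pos (t - s)
  have ht := decayRate_pos t
  rcases le_total s (t - s) with hle | hle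
  · calc _ ≤ 2 * decayRate t * decayRate s ^ 5 := by
          gcongr
          exact decayRate_le_two_mul (by omega)
      _ ≤ _ := by
          gcongr
          have := pow_pos hts 5
          linarith
  · have h1 : decayRate s ≤ decayRate (t - s) := by
      refine Real.rpow_le_rpow_of_nonpos (by positivity) ?_ (by norm_num)
      have : ((t - s : ℕ) : ℝ) ≤ s := by exact_mod_cast hle
      linarith
    calc _ = decayRate s * (decayRate (t - s) * decayRate s ^ 4) := by ring
      _ ≤ 2 * decayRate t * (decayRate (t - s) * decayRate (t - s) ^ 4) := by
          gcongr
          exact decayRate_le_two_mul (by omega)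
      _ = 2 * decayRate t * decayRate (t - s) ^ 5 := by ring
      _ ≤ _ := by
          gcongr
          have := pow_pos hs 5
          linarith

lemma exists_sum_decayRate_le : ∃ B : ℝ, 0 < B ∧ ∀ t,
    ∑ s ∈ Finset.range t, decayRate (t - s) * decayRate s ^ 5 ≤ B * decayRate t := by
  set B₀ := ∑' t, decayRate t ^ 5 with hB₀
  have hnn : ∀ t, 0 ≤ decayRate t ^ 5 := fun t => (pow_pos (decayRate_pos t) 5).le
  have hB : ∀ S : Finset ℕ, ∑ s ∈ S, decayRate s ^ 5 ≤ B₀ := fun S =>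
    summable_decayRate_pow_five.sum_le_tsum S fun t _ => hnn t
  have hpos : 0 < B₀ := by
    have := hB {0}
    rw [Finset.sum_singleton] at this
    exact (pow_pos (decayRate_pos 0) 5).trans_le this
  refine ⟨4 * B₀, by positivity, fun t => ?_⟩
  have ht := decayRate_pos t
  calc _ ≤ ∑ s ∈ Finset.range t, 2 * decayRate t * (decayRate s ^ 5 + decayRate (t - s) ^ 5) :=
        Finset.sum_le_sum fun s hs => decayRate_mul_pow_five_le (Finset.mem_range.1 hs)
    _ = 2 * decayRate t * (∑ s ∈ Finset.range t, decayRate s ^ 5 +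
          ∑ s ∈ Finset.range t, decayRate (t - s) ^ 5) := by
        rw [← Finset.mul_sum, Finset.sum_add_distrib]
    _ ≤ 2 * decayRate t * (B₀ + B₀) := by
        gcongr
        · exact hB _
        · refine le_trans (le_of_eq ?_) (hB ((Finset.range t).image fun s => t - s))
          rw [Finset.sum_image]
          intro p hp q hq hpq
          have := Finset.mem_range.1 hp
          have := Finset.mem_range.1 hq
          simp only at hpq
          omega
    _ = _ := by ring

/-! ### Small data in l¹ -/

section SmallL1

variable {a b : ℂ} (hab : ‖a‖ ^ 2 + ‖b‖ ^ 2 = 1) (CN : ℝ → ℝ → Matrix.unitaryGroup (Fin 2) ℂ)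

/-- A quintic nonlinearity maps l⁵ back to l¹, the space from which the linear decay starts. -/
lemma tsum_norm_le_of_pow_five {K : ℝ} {u v : State} (h : ∀ x, ‖v x‖ ≤ K * ‖u x‖ ^ 5) :
    Summable (fun x => ‖v x‖) ∧ ∑' x, ‖v x‖ ≤ K * ‖inclusionL5 u‖ ^ 5 := by
  have h1 : Summable fun x => K * ‖u x‖ ^ 5 := (summable_norm_pow_five (inclusionL5 u)).mul_left K
  have h2 := h1.of_nonneg_of_le (fun _ => norm_nonneg _) h
  refine ⟨h2, (h2.tsum_le_tsum h h1).trans_eq ?_⟩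
  rw [norm_pow_five_eq_tsum, tsum_mul_left]
  rfl

/-- Scattering of small solutions in `l¹` for nonlinearities of order five. -/
theorem exists_scatters_l1 (ha₀ : 0 < ‖a‖) (ha₁ : ‖a‖ < 1) (h : NearIdentity CN 2) :
    ∃ δ : ℝ, 0 < δ ∧ ∀ u₀ : SeqSpace 1, ‖u₀‖ < δ →
      Scatters (constCoin a b hab) (fun s₁ s₂ => constCoin a b hab * CN s₁ s₂)
        (inclusionL1 u₀) := by
  obtain ⟨K, hK0, hK'⟩ := exists_norm_nonlinearity_apply_le h
  have hK : ∀ (u : State) (x : ℤ), ‖nonlinearity CN u x‖ ≤ K * ‖u x‖ ^ 5 := fun u x =>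
    (hK' u x).trans_eq (by ring)
  obtain ⟨D, hD0, hD⟩ := exists_inclusionL5_le hab ha₀ ha₁
  obtain ⟨B, hB0, hB⟩ := exists_sum_decayRate_le
  -- The 32 is the fifth power of the 2 in the bootstrap bound 2Dε; the summand 1 forces ε ≤ 1, so
  -- that ε⁴ ≤ ε.
  refine ⟨(1 + 32 * K * B * D ^ 5)⁻¹, by positivity, fun u₁ hu₁ => ?_⟩
  set u₀ : State := inclusionL1 u₁ with hu₀
  set u := solution hab CN u₀ with hu
  set ε := ‖u₁‖ with hε
  have hε0 : 0 ≤ ε := norm_nonneg _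
  have hε1 : ε ≤ 1 := hu₁.le.trans (inv_le_one_of_one_le₀ (le_add_of_nonneg_right (by positivity)))
  have hsmall : 32 * K * B * D ^ 5 * ε ^ 4 ≤ 1 := by
    have h1 : ε ^ 4 ≤ ε := pow_le_of_le_one hε0 hε1 (by norm_num)
    have h2 : (1 + 32 * K * B * D ^ 5) * ε ≤ 1 := by
      have h3 := mul_le_mul_of_nonneg_left hu₁.le
        (by positivity : 0 ≤ 1 + 32 * K * B * D ^ 5)
      rwa [mul_inv_cancel₀ (by positivity)] at h3
    have h4 : 32 * K * B * D ^ 5 * ε ^ 4 ≤ 32 * K * B * D ^ 5 * ε := by gcongr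
    linarith
  have hl1 : Summable fun x => ‖u₀ x‖ := by
    have h1 := (memℓp_gen_iff (by norm_num)).1 (lp.memℓp u₁)
    have h2 : Summable fun x => ‖u₁ x‖ := by simpa using h1
    exact h2
  have hl1' : ∑' x, ‖u₀ x‖ = ε := by
    have h1 := lp.norm_rpow_eq_tsum (p := 1) (by norm_num) u₁
    simp only [ENNReal.toReal_one, Real.rpow_one] at h1
    rw [hε, h1]
    rfl
  have hN := fun t => tsum_norm_le_of_pow_five (hK (u t))
  -- Bootstrap by strong induction: the free part accounts for one Dε, and the nonlinear part, being
  -- of order ε⁵, fits into the other.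
  have hq : ∀ t, ‖inclusionL5 (u t)‖ ≤ 2 * D * ε * decayRate t := by
    intro t
    induction t using Nat.strong_induction_on with
    | _ t ih =>
      have hr := decayRate_pos t
      have h1 : ‖inclusionL5 (u t)‖ ≤ ‖inclusionL5 ((linearWalk a b hab ^ t) u₀)‖ +
          ∑ s ∈ Finset.range t,
            ‖inclusionL5 ((linearWalk a b hab ^ t) (pulledBackTerm hab CN u₀ s))‖ := by
        rw [hu, solution_eq, map_add, map_add, map_sum, map_sum]
        exact (norm_add_le _ _).trans (add_le_add_right (norm_sum_le _ _) _)
      have h2 : ‖inclusionL5 ((linearWalk a b hab ^ t) u₀)‖ ≤ D * decayRate t * ε := by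
        have := hD t u₀ hl1
        rwa [hl1'] at this
      have h3 : ∀ s ∈ Finset.range t,
          ‖inclusionL5 ((linearWalk a b hab ^ t) (pulledBackTerm hab CN u₀ s))‖ ≤
            D * K * (2 * D * ε) ^ 5 * (decayRate (t - s) * decayRate s ^ 5) := fun s hs => by
        have hst := Finset.mem_range.1 hs
        rw [pulledBackTerm, linearWalk_pow_symm hab t s hst.le]
        have hr' := decayRate_pos (t - s)
        calc _ ≤ D * decayRate (t - s) * ∑' x, ‖nonlinearity CN (u s) x‖ := hD _ _ (hN s).1
          _ ≤ D * decayRate (t - s) * (K * (2 * D * ε * decayRate s) ^ 5) := by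
              gcongr
              refine (hN s).2.trans ?_
              gcongr
              exact ih s hst
          _ = _ := by ring
      have h4 := Finset.sum_le_sum h3
      rw [← Finset.mul_sum] at h4
      have h5 : D * K * (2 * D * ε) ^ 5 *
          ∑ s ∈ Finset.range t, decayRate (t - s) * decayRate s ^ 5 ≤
          D * K * (2 * D * ε) ^ 5 * (B * decayRate t) := by
        gcongr
        exact hB t
      have h6 : D * K * (2 * D * ε) ^ 5 * (B * decayRate t) ≤ D * ε * decayRate t := by
        calc _ = D * ε * decayRate t * (32 * K * B * D ^ 5 * ε ^ 4) := by ring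
          _ ≤ D * ε * decayRate t * 1 := by gcongr
          _ = _ := mul_one _
      linarith
  -- The l² norm is at most the l¹ norm, which decays like the fifth power of the rate, that is (1 +
  -- t)^{-9/8}.
  refine scatters_of_summable hab CN u₀ ?_
  refine (summable_decayRate_pow_five.mul_left (K * (2 * D * ε) ^ 5)).of_nonneg_of_le
    (fun _ => norm_nonneg _) fun t => ?_
  calc _ ≤ ∑' x, ‖nonlinearity CN (u t) x‖ := norm_le_tsum_norm _ (hN t).1
    _ ≤ K * ‖inclusionL5 (u t)‖ ^ 5 := (hN t).2
    _ ≤ K * (2 * D * ε * decayRate t) ^ 5 := by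
        gcongr
        exact hq t
    _ = _ := by ring

end SmallL1

end NLQW

theorem mainTheorem1 (a b : ℂ) (hab : ‖a‖ ^ 2 + ‖b‖ ^ 2 = 1) (ha₀ : 0 < ‖a‖) (ha₁ : ‖a‖ < 1)
    (CN : ℝ → ℝ → Matrix.unitaryGroup (Fin 2) ℂ) :
    (NLQW.NearIdentity CN 3 →
      ∃ δ : ℝ, 0 < δ ∧ ∀ u₀ : NLQW.State, ‖u₀‖ < δ →
        NLQW.Scatters (NLQW.constCoin a b hab)
          (fun s₁ s₂ => NLQW.constCoin a b hab * CN s₁ s₂) u₀) ∧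
    (NLQW.NearIdentity CN 2 →
      ∃ δ : ℝ, 0 < δ ∧ ∀ u₀ : NLQW.SeqSpace 1, ‖u₀‖ < δ →
        NLQW.Scatters (NLQW.constCoin a b hab)
          (fun s₁ s₂ => NLQW.constCoin a b hab * CN s₁ s₂) (NLQW.inclusionL1 u₀)) := by
  exact ⟨NLQW.exists_scatters_l2 hab CN ha₀ ha₁, NLQW.exists_scatters_l1 hab CN ha₀ ha₁⟩
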